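/- **Theorem.** Let $d,m\in\mathbb N$, $m\ge 1$, $\lambda>0$, $a_i\in\mathbb R^d$, $b_i\in\mathbb R$ ($i=1,\dots,m$), and let $$f(x)=\lambda\|x\|_4^4+\frac1m\sum_{i=1}^m\max\{0,\,1-b_i\langle a_i,x\rangle\},\qquad \tilde Q=[\,b_1a_1\ \ b_2a_2\ \cdots\ b_ma_m\,]^\top\in\mathbb R^{m\times d}.$$ Write $\|\tilde Q^\top\tilde Q\|$ for the spectral norm. For $\varepsilon>0$ let $\mu=\varepsilon/4$ and let $$f_\mu(x)=\lambda\|x\|_4^4+\frac1m\sum_{i=1}^m\mu\log\bigl(1+e^{(1-b_i\langle a_i,x\rangle)/\mu}\bigr)$$ be the smoothed objective. An *iterative method* is started at a point $x_0$ and produces iterates $x_0,x_1,x_2,\dots$; it has access to the data $(a_i,b_i)$ only through the numbers it is given as parameters and through calls made adaptively during its iterations, each call being either to a *gradient oracle* ($x\mapsto\nabla f_\mu(x)$) or to a *linear system solver* ($(x,c,v)\mapsto$ the solution $u$ of $(\nabla^2 f_\mu(x)+cI)u=v$, where $c>0$). Its cost is measured by the number of iterations and the number of calls per iteration. Logarithms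 inside $O(\cdot)$ are read as $\overline{\log}\,t=\max\{1,\log t\}$. There are universal constants $C>0$ and $k\in\mathbb N$, a universal polynomial $P$ with coefficients in $\mathbb N$, and a family of iterative methods with parameters $d,m,\lambda,\|\tilde Q^\top\tilde Q\|,\varepsilon$ such that for all $d$, $m\ge1$, $\lambda>0$, $\varepsilon>0$, $(a_i)$, $(b_i)$ and $x_0\in\mathbb R^d$ as above, $f$ attains its minimum at some $x^*$, the iterates of the method started at $x_0$ satisfy $$f(x_N)-f(x^*)\le\varepsilon\qquad\text{for every integer }N\ \ge\ C\,\frac{\bigl(d\,(\lambda+\|\tilde Q^\top\tilde Q\|^2)/\lambda\bigr)^{1/5}}{\varepsilon^{3/5}}\ \overline{\log}\!\left(\frac{f(x_0)-f(x^*)}{\varepsilon}\right),$$ and every iteration makes at most $C\,\overline{\log}(\mathcal Z/\varepsilon)^{k}$ calls to the gradient oracle and the linear system solver in total, where $\mathcal Z=P\bigl(d,m,\lambda,\lambda^{-1},\|\tilde Q^\top\tilde Q\|,\|x_0\|\bigr)$. -/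

import Mathlib

noncomputable section

/-- The data matrix `Q̃ = [b₁a₁ b₂a₂ … bₘaₘ]ᵀ`. -/
def dataMatrix {d m : ℕ} (a : Fin m → EuclideanSpace ℝ (Fin d)) (b : Fin m → ℝ) :
    Matrix (Fin m) (Fin d) ℝ :=
  Matrix.of fun i j => b i * a i j

/-- The spectral norm `‖Q̃ᵀ Q̃‖`, that is, the operator norm of `Q̃ᵀ Q̃` on Euclidean space
(which is its largest eigenvalue). -/
def gramNorm {d m : ℕ} (a : Fin m → EuclideanSpace ℝ (Fin d)) (b : Fin m → ℝ) : ℝ :=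
  ‖Matrix.toEuclideanCLM (𝕜 := ℝ) ((dataMatrix a b).transpose * dataMatrix a b)‖

/-- The fourth power of the `ℓ₄` norm, `‖x‖₄⁴ = ∑ᵢ xᵢ⁴`. -/
def l4pow {d : ℕ} (x : EuclideanSpace ℝ (Fin d)) : ℝ := ∑ i, x i ^ 4

/-- The `ℓ₄`-SVM objective `λ‖x‖₄⁴ + (1/m) ∑ᵢ max{0, 1 - bᵢ⟨aᵢ, x⟩}`. -/
def svmObj {d m : ℕ} (lam : ℝ) (a : Fin m → EuclideanSpace ℝ (Fin d)) (b : Fin m → ℝ)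
    (x : EuclideanSpace ℝ (Fin d)) : ℝ :=
  lam * l4pow x + (1 / (m : ℝ)) * ∑ i, max 0 (1 - b i * inner ℝ (a i) x)

/-- The softmax approximation `smax_μ(x) = μ log ∑ᵢ exp (xᵢ/μ)` of the maximum. -/
def smax {n : ℕ} (mu : ℝ) (x : Fin n → ℝ) : ℝ :=
  mu * Real.log (∑ i, Real.exp (x i / mu))

/-- The smooth hinge `shinge_μ(c) = smax_μ([0, c])`. -/
def shinge (mu c : ℝ) : ℝ := smax mu ![0, c]

/-- The smoothed objective `f_μ(x) = λ‖x‖₄⁴ + (1/m) ∑ᵢ shinge_μ(1 - bᵢ⟨aᵢ, x⟩)`. -/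
def smoothObj {d m : ℕ} (mu lam : ℝ) (a : Fin m → EuclideanSpace ℝ (Fin d)) (b : Fin m → ℝ)
    (x : EuclideanSpace ℝ (Fin d)) : ℝ :=
  lam * l4pow x + (1 / (m : ℝ)) * ∑ i, shinge mu (1 - b i * inner ℝ (a i) x)

/-- The answer of the gradient oracle of `F` to the query `x`. -/
def gradOracle {d : ℕ} (F : EuclideanSpace ℝ (Fin d) → ℝ) (x : EuclideanSpace ℝ (Fin d)) :
    EuclideanSpace ℝ (Fin d) :=
  gradient F x

/-- The answer of the linear system solver for `F` to the query `(x, c, v)`: the solution `u` of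
`(∇²F(x) + c I) u = v`. For `c > 0` and `F` smooth and convex the system is invertible. -/
def solveOracle {d : ℕ} (F : EuclideanSpace ℝ (Fin d) → ℝ) (x : EuclideanSpace ℝ (Fin d))
    (c : ℝ) (v : EuclideanSpace ℝ (Fin d)) : EuclideanSpace ℝ (Fin d) :=
  (fderiv ℝ (gradient F) x + c • ContinuousLinearMap.id ℝ (EuclideanSpace ℝ (Fin d))).inverse v

/-- A deterministic adaptive procedure with values in `α` that learns about the function only by
calling a gradient oracle and a linear system solver: it stops with a value, or makes one call
and continues in a way that depends on the answer. -/
inductive OracleProc (d : ℕ) (α : Type) : Type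
  | done (val : α) : OracleProc d α
  | grad (x : EuclideanSpace ℝ (Fin d))
      (next : EuclideanSpace ℝ (Fin d) → OracleProc d α) : OracleProc d α
  | solve (x : EuclideanSpace ℝ (Fin d)) (c : ℝ) (hc : 0 < c) (v : EuclideanSpace ℝ (Fin d))
      (next : EuclideanSpace ℝ (Fin d) → OracleProc d α) : OracleProc d α

/-- The value returned by a procedure when its calls are answered for the function `F`. -/
def OracleProc.result {d : ℕ} {α : Type} (F : EuclideanSpace ℝ (Fin d) → ℝ) :
    OracleProc d α → α
  | .done val => val
  | .grad x next => (next (gradOracle F x)).result F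
  | .solve x c _ v next => (next (solveOracle F x c v)).result F

/-- The total number of calls (to the gradient oracle and to the linear system solver) that a
procedure makes when its calls are answered for the function `F`. -/
def OracleProc.calls {d : ℕ} {α : Type} (F : EuclideanSpace ℝ (Fin d) → ℝ) :
    OracleProc d α → ℕ
  | .done _ => 0
  | .grad x next => (next (gradOracle F x)).calls F + 1
  | .solve x c _ v next => (next (solveOracle F x c v)).calls F + 1

/-- An iterative method on `ℝᵈ`: it is initialized with a point `x₀`, its first iterate, and each
iteration is an oracle procedure that turns the current state into the next one. The method has
no access to the function except through the oracle calls of its iterations. -/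
structure IterMethod (d : ℕ) where
  /-- the internal memory -/
  State : Type
  /-- the state in which the method starts when it is initialized with `x₀` -/
  init : EuclideanSpace ℝ (Fin d) → State
  /-- one iteration -/
  step : State → OracleProc d State
  /-- the iterate that belongs to a state -/
  point : State → EuclideanSpace ℝ (Fin d)
  point_init : ∀ x₀, point (init x₀) = x₀

/-- The state after `n` iterations on the function `F`, initialized with `x₀`. -/
def IterMethod.state {d : ℕ} (A : IterMethod d) (F : EuclideanSpace ℝ (Fin d) → ℝ)
    (x₀ : EuclideanSpace ℝ (Fin d)) : ℕ → A.State
  | 0 => A.init x₀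
  | n + 1 => (A.step (A.state F x₀ n)).result F

/-- The iterate `x_n` after `n` iterations on `F`. -/
def IterMethod.iter {d : ℕ} (A : IterMethod d) (F : EuclideanSpace ℝ (Fin d) → ℝ)
    (x₀ : EuclideanSpace ℝ (Fin d)) (n : ℕ) : EuclideanSpace ℝ (Fin d) :=
  A.point (A.state F x₀ n)

/-- The number of oracle calls made by the iteration that leads from `x_n` to `x_{n+1}`. -/
def IterMethod.iterCalls {d : ℕ} (A : IterMethod d) (F : EuclideanSpace ℝ (Fin d) → ℝ)
    (x₀ : EuclideanSpace ℝ (Fin d)) (n : ℕ) : ℕ :=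
  (A.step (A.state F x₀ n)).calls F

/-- The logarithm as it is read inside `O(·)`: never smaller than one. -/
def logO (t : ℝ) : ℝ := max 1 (Real.log t)

end

/-! Only oracle calls are charged, so internal computation, including implicit choices, is free.
Gradient calls alone suffice. Write `B` for `budget`, so that `B ^ 5 = d (λ + G²) / (λ ε³)`. Each
iteration runs a logarithmic number `K` of gradient steps, and `10 B` iterations are enough; the
logarithm in the iteration bound is not needed. Passing from `f` to `f_μ` costs at most `μ = ε/4`,
so accuracy `ε/2` for `f_μ` suffices. If `ε ≥ 1` the origin works, since `f 0 ≤ 1` and `f ≥ 0`.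
Otherwise `m ^ 2` is compared with `B`.

Few data points (`m ^ 2 ≤ B`). The loss gradients lie in an unknown space `V` of dimension at most
`m`, so an ellipsoid method needs only `O(m² log)` calls, independently of `d` up to logarithms. The
quartic gradient need not lie in `V`. To repair this, the query minimizes `‖x‖₄⁴` on the fibre over
the projection of the centre to the span `S` of the loss gradients seen so far
(`exists_l4pow_min_on_fiber`); there the quartic gradient lies in `S`. Either the loss gradient is
also in `S` and gives a central cut, or `S` grows, which happens at most `m` times
(`CutState.invariant_micro`). All cuts have directions in `V`, so at most `m` eigenvalues of the
form move, and the volume argument runs in dimension `m` (`Ellipsoid.Valid.count_le`). Function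
values are not available, so the output is a convex combination of queries whose optimality is
certified by the gradients (`exists_cut_weights`, `IsCertified.le`).

Many data points (`m ^ 2 > B`). The averaged loss has smoothness constant `L = 8G/(mε)`, which is
small because `m` is large. The quartic gives the growth `λ‖p - u‖⁴ ≤ 3d (F p - F u)`
(`norm_sub_pow_four_le`). An accelerated proximal method that treats the quartic exactly, restarted
every `T` steps, therefore halves the gap in each phase once `96 L² d ≤ λ ε T⁴`
(`accelMachine_gap`). By `m ^ 2 > B` this holds for `T = ⌈9B⌉`. -/

/-! ### Gradient-only procedures packed into iterative methods -/

/-- A procedure that queries a gradient oracle once per step. -/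
structure GradMachine (d : ℕ) where
  /-- the memory -/
  Mem : Type
  /-- the initial memory -/
  start : Mem
  /-- the next query -/
  query : Mem → EuclideanSpace ℝ (Fin d)
  /-- the new memory after the answer -/
  update : Mem → EuclideanSpace ℝ (Fin d) → Mem
  /-- the point proposed at the current time -/
  output : Mem → EuclideanSpace ℝ (Fin d)

namespace GradMachine

variable {d : ℕ}

/-- One step of the machine when its query is answered by `g`. -/
def micro (M : GradMachine d) (g : EuclideanSpace ℝ (Fin d) → EuclideanSpace ℝ (Fin d))
    (s : M.Mem) : M.Mem :=
  M.update s (g (M.query s))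

/-- The oracle procedure that performs `K` steps of the machine. -/
def run (M : GradMachine d) : ℕ → M.Mem → OracleProc d (EuclideanSpace ℝ (Fin d) × M.Mem)
  | 0, s => .done (M.output s, s)
  | K + 1, s => .grad (M.query s) fun v => M.run K (M.update s v)

/-- The iterative method each of whose iterations performs `K` steps of the machine. -/
def toMethod (M : GradMachine d) (K : ℕ) : IterMethod d where
  State := EuclideanSpace ℝ (Fin d) × M.Mem
  init x₀ := (x₀, M.start)
  step s := M.run K s.2
  point s := s.1
  point_init _ := rfl

theorem run_result (M : GradMachine d) (F : EuclideanSpace ℝ (Fin d) → ℝ) (K : ℕ) (s : M.Mem) :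
    (M.run K s).result F =
      (M.output ((M.micro (gradient F))^[K] s), (M.micro (gradient F))^[K] s) := by
  induction K generalizing s with
  | zero => rfl
  | succ K ih => exact ih _

theorem run_calls (M : GradMachine d) (F : EuclideanSpace ℝ (Fin d) → ℝ) (K : ℕ) (s : M.Mem) :
    (M.run K s).calls F = K := by
  induction K generalizing s with
  | zero => rfl
  | succ K ih => exact congrArg (· + 1) (ih _)

/-- Consecutive iterations form one uninterrupted run of the machine, so a restart phase may
straddle iterations. The starting point is used only as iterate zero. -/
theorem toMethod_state (M : GradMachine d) (K : ℕ) (F : EuclideanSpace ℝ (Fin d) → ℝ)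
    (x₀ : EuclideanSpace ℝ (Fin d)) (n : ℕ) :
    ((M.toMethod K).state F x₀ n).2 = (M.micro (gradient F))^[K * n] M.start := by
  induction n with
  | zero => rfl
  | succ n ih =>
    have h : ((M.toMethod K).state F x₀ (n + 1)) =
      (M.run K ((M.toMethod K).state F x₀ n).2).result F := rfl
    rw [h, run_result, ih, ← Function.iterate_add_apply, Nat.mul_succ, Nat.add_comm]

theorem toMethod_iter (M : GradMachine d) (K : ℕ) (F : EuclideanSpace ℝ (Fin d) → ℝ)
    (x₀ : EuclideanSpace ℝ (Fin d)) {n : ℕ} (hn : n ≠ 0) :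
    (M.toMethod K).iter F x₀ n = M.output ((M.micro (gradient F))^[K * n] M.start) := by
  obtain ⟨n, rfl⟩ := Nat.exists_eq_succ_of_ne_zero hn
  have h : (M.toMethod K).iter F x₀ (n + 1) =
    ((M.run K ((M.toMethod K).state F x₀ n).2).result F).1 := rfl
  rw [h, run_result, toMethod_state, ← Function.iterate_add_apply, Nat.mul_succ, Nat.add_comm]

theorem toMethod_iterCalls (M : GradMachine d) (K : ℕ) (F : EuclideanSpace ℝ (Fin d) → ℝ)
    (x₀ : EuclideanSpace ℝ (Fin d)) (n : ℕ) : (M.toMethod K).iterCalls F x₀ n = K :=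
  M.run_calls F K _

end GradMachine

/-! ### The smooth hinge -/

theorem shinge_eq (mu c : ℝ) : shinge mu c = mu * Real.log (1 + Real.exp (c / mu)) := by
  simp [shinge, smax]

theorem one_sub_sigmoid_add_mul_exp (c t : ℝ) :
    (1 - Real.sigmoid c) + Real.sigmoid c * Real.exp t =
      (1 + Real.exp (c + t)) / (1 + Real.exp c) := by
  have h1 : Real.sigmoid c = Real.exp c / (1 + Real.exp c) := by
    rw [Real.sigmoid, Real.exp_neg]; have := Real.exp_pos c; field_simp; ring
  rw [h1, Real.exp_add]; have := Real.exp_pos c; field_simp; ring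

/-- Jensen for `exp` at `0` and `t` with weights `1 - σ(c)` and `σ(c)`, followed by a logarithm.
This yields convexity without second derivatives. -/
theorem log_one_add_exp_tangent (c t : ℝ) :
    Real.log (1 + Real.exp c) + Real.sigmoid c * t ≤ Real.log (1 + Real.exp (c + t)) := by
  have h1 := convexOn_exp.2 (Set.mem_univ (0 : ℝ)) (Set.mem_univ t)
    (sub_nonneg.2 (Real.sigmoid_le_one c)) (Real.sigmoid_nonneg c) (by ring)
  simp only [smul_eq_mul, mul_zero, zero_add, Real.exp_zero, mul_one] at h1
  rw [one_sub_sigmoid_add_mul_exp] at h1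
  have h2 := Real.exp_pos c
  have h3 := Real.exp_pos (c + t)
  have h4 := Real.log_le_log (Real.exp_pos _) h1
  rw [Real.log_exp, Real.log_div (by positivity) (by positivity)] at h4
  linarith

theorem abs_sigmoid_sub_le (s t : ℝ) : |Real.sigmoid t - Real.sigmoid s| ≤ |t - s| := by
  have h := Convex.norm_image_sub_le_of_norm_deriv_le (f := Real.sigmoid) (C := 1)
    (s := Set.univ) (x := s) (y := t) (fun x _ => (Real.hasDerivAt_sigmoid x).differentiableAt) (fun x _ => by
      rw [Real.deriv_sigmoid, Real.norm_eq_abs, abs_of_nonneg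
        (mul_nonneg (Real.sigmoid_nonneg x) (sub_nonneg.2 (Real.sigmoid_le_one x)))]
      nlinarith [Real.sigmoid_nonneg x, Real.sigmoid_le_one x])
    convex_univ (Set.mem_univ _) (Set.mem_univ _)
  simpa using h

theorem shinge_tangent {mu : ℝ} (hmu : 0 < mu) (c c' : ℝ) :
    shinge mu c + Real.sigmoid (c / mu) * (c' - c) ≤ shinge mu c' := by
  rw [shinge_eq, shinge_eq]
  have h := mul_le_mul_of_nonneg_left
    (log_one_add_exp_tangent (c / mu) (c' / mu - c / mu)) hmu.le
  rw [add_sub_cancel] at h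
  refine le_trans (le_of_eq ?_) h
  field_simp

/-- The tangent inequality at `c'`, read backwards, leaves the change of slope times `c' - c`. The
sigmoid is 1-Lipschitz, which is not sharp but enough here. -/
theorem shinge_upper {mu : ℝ} (hmu : 0 < mu) (c c' : ℝ) :
    shinge mu c' ≤ shinge mu c + Real.sigmoid (c / mu) * (c' - c) + mu⁻¹ * (c' - c) ^ 2 := by
  have h1 := shinge_tangent hmu c' c
  have h2 := abs_sigmoid_sub_le (c / mu) (c' / mu)
  have h3 : (Real.sigmoid (c' / mu) - Real.sigmoid (c / mu)) * (c' - c) ≤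
      mu⁻¹ * (c' - c) ^ 2 := by
    calc _ ≤ |(Real.sigmoid (c' / mu) - Real.sigmoid (c / mu)) * (c' - c)| := le_abs_self _
      _ = |Real.sigmoid (c' / mu) - Real.sigmoid (c / mu)| * |c' - c| := abs_mul _ _
      _ ≤ |c' / mu - c / mu| * |c' - c| := by gcongr
      _ = mu⁻¹ * (c' - c) ^ 2 := by
        rw [← sub_div, abs_div, abs_of_pos hmu, ← sq_abs (c' - c)]; field_simp
  nlinarith

theorem max_le_shinge {mu : ℝ} (hmu : 0 < mu) (c : ℝ) : max 0 c ≤ shinge mu c := by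
  rw [shinge_eq]
  have h0 := Real.exp_pos (c / mu)
  refine max_le (mul_nonneg hmu.le (Real.log_nonneg (by linarith))) ?_
  have h := Real.log_le_log h0 (by linarith : Real.exp (c / mu) ≤ 1 + Real.exp (c / mu))
  rw [Real.log_exp] at h
  calc c = mu * (c / mu) := by field_simp
    _ ≤ _ := mul_le_mul_of_nonneg_left h hmu.le

theorem shinge_le {mu : ℝ} (hmu : 0 < mu) (c : ℝ) : shinge mu c ≤ max 0 c + mu := by
  rw [shinge_eq]
  have h0 := Real.exp_pos (c / mu)
  have h1 : 1 + Real.exp (c / mu) ≤ 2 * Real.exp (max 0 c / mu) := by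
    have ha : (1 : ℝ) ≤ Real.exp (max 0 c / mu) := Real.one_le_exp (by positivity)
    have hb : Real.exp (c / mu) ≤ Real.exp (max 0 c / mu) :=
      Real.exp_le_exp.2 (by gcongr; exact le_max_right _ _)
    linarith
  have h2 := Real.log_le_log (by linarith) h1
  rw [Real.log_mul two_ne_zero (Real.exp_pos _).ne', Real.log_exp] at h2
  have h3 := Real.log_two_lt_d9
  calc mu * Real.log (1 + Real.exp (c / mu)) ≤ mu * (1 + max 0 c / mu) :=
        mul_le_mul_of_nonneg_left (by linarith) hmu.le
    _ = max 0 c + mu := by field_simp; ring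

theorem hasDerivAt_shinge {mu : ℝ} (hmu : 0 < mu) (c : ℝ) :
    HasDerivAt (shinge mu) (Real.sigmoid (c / mu)) c := by
  have h0 := Real.exp_pos (c / mu)
  have h := ((((hasDerivAt_id c).div_const mu).exp.const_add 1).log
    (by simp only [id]; positivity)).const_mul mu
  have he : shinge mu = fun c => mu * Real.log (1 + Real.exp (id c / mu)) := by
    funext c; exact shinge_eq mu c
  rw [he]
  refine h.congr_deriv ?_
  rw [Real.sigmoid, Real.exp_neg, id]
  field_simp
  ring

/-! ### The averaged loss: gradient, convexity and smoothness -/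

section Average

variable {d m : ℕ} (mu : ℝ) (a : Fin m → EuclideanSpace ℝ (Fin d)) (b : Fin m → ℝ)

/-- The average smooth hinge loss. -/
noncomputable def hingeAvg (x : EuclideanSpace ℝ (Fin d)) : ℝ :=
  (1 / (m : ℝ)) * ∑ i, shinge mu (1 - b i * inner ℝ (a i) x)

/-- The gradient of the average smooth hinge loss. -/
noncomputable def hingeGrad (x : EuclideanSpace ℝ (Fin d)) : EuclideanSpace ℝ (Fin d) :=
  ∑ i, (-((1 / (m : ℝ)) * Real.sigmoid ((1 - b i * inner ℝ (a i) x) / mu))) • (b i • a i)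

theorem inner_hingeGrad (x v : EuclideanSpace ℝ (Fin d)) :
    inner ℝ (hingeGrad mu a b x) v = (1 / (m : ℝ)) *
      ∑ i, Real.sigmoid ((1 - b i * inner ℝ (a i) x) / mu) * (-(b i * inner ℝ (a i) v)) := by
  simp only [hingeGrad, sum_inner, real_inner_smul_left, Finset.mul_sum]
  exact Finset.sum_congr rfl fun i _ => by ring

theorem hingeGrad_mem_span (x : EuclideanSpace ℝ (Fin d)) :
    hingeGrad mu a b x ∈ Submodule.span ℝ (Set.range fun i => b i • a i) :=
  Submodule.sum_mem _ fun i _ => Submodule.smul_mem _ _ (Submodule.subset_span ⟨i, rfl⟩)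

theorem sum_sq_inner_le_gramNorm (v : EuclideanSpace ℝ (Fin d)) :
    ∑ i, (b i * inner ℝ (a i) v) ^ 2 ≤ gramNorm a b * ‖v‖ ^ 2 := by
  have h1 : ∑ i, (b i * inner ℝ (a i) v) ^ 2 = inner ℝ v
      (Matrix.toEuclideanCLM (𝕜 := ℝ) ((dataMatrix a b).transpose * dataMatrix a b) v) := by
    have h2 : ∀ i, b i * inner ℝ (a i) v = (dataMatrix a b).mulVec v.ofLp i := by
      intro i
      simp [dataMatrix, Matrix.mulVec, dotProduct, PiLp.inner_apply, Finset.mul_sum]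
      exact Finset.sum_congr rfl fun j _ => by ring
    rw [EuclideanSpace.inner_eq_star_dotProduct, Matrix.ofLp_toEuclideanCLM,
      ← Matrix.mulVec_mulVec, star_trivial, Matrix.mulVec_transpose, ← Matrix.dotProduct_mulVec]
    simp only [h2, dotProduct, sq]
  rw [h1]
  calc _ ≤ ‖v‖ * ‖Matrix.toEuclideanCLM (𝕜 := ℝ)
        ((dataMatrix a b).transpose * dataMatrix a b) v‖ := real_inner_le_norm _ _
    _ ≤ ‖v‖ * (gramNorm a b * ‖v‖) := by
      gcongr; exact ContinuousLinearMap.le_opNorm _ _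
    _ = _ := by ring

theorem gramNorm_nonneg : 0 ≤ gramNorm a b := norm_nonneg _

/-- Testing the Gram form on `v = bᵢaᵢ` gives `‖v‖⁴ ≤ G‖v‖²`; the bound `1 + G` avoids a square
root. -/
theorem norm_smul_le_one_add_gramNorm (i : Fin m) : ‖b i • a i‖ ≤ 1 + gramNorm a b := by
  have h1 := (Finset.single_le_sum (f := fun j => (b j * inner ℝ (a j) (b i • a i)) ^ 2)
    (fun _ _ => sq_nonneg _) (Finset.mem_univ i)).trans (sum_sq_inner_le_gramNorm a b (b i • a i))
  have h2 : b i * inner ℝ (a i) (b i • a i) = ‖b i • a i‖ ^ 2 := by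
    rw [← real_inner_self_eq_norm_sq, real_inner_smul_left]
  simp only [h2] at h1
  have hG := gramNorm_nonneg a b
  have hn := norm_nonneg (b i • a i)
  by_contra! hlt
  have h3 : gramNorm a b < ‖b i • a i‖ ^ 2 := by nlinarith
  have h4 : 0 < ‖b i • a i‖ ^ 2 := by nlinarith
  nlinarith

theorem norm_hingeGrad_le (x : EuclideanSpace ℝ (Fin d)) (hm : 0 < m) :
    ‖hingeGrad mu a b x‖ ≤ 1 + gramNorm a b := by
  have hm' : (0 : ℝ) < m := by exact_mod_cast hm
  calc _ ≤ ∑ i : Fin m, (1 / (m : ℝ)) * (1 + gramNorm a b) := by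
        refine norm_sum_le_of_le _ fun i _ => ?_
        rw [norm_smul, norm_neg, norm_mul, Real.norm_of_nonneg (by positivity),
          Real.norm_of_nonneg (Real.sigmoid_nonneg _)]
        have h1 := Real.sigmoid_le_one ((1 - b i * inner ℝ (a i) x) / mu)
        have h2 := norm_smul_le_one_add_gramNorm a b i
        have h3 := Real.sigmoid_nonneg ((1 - b i * inner ℝ (a i) x) / mu)
        have h4 : 1 / (m : ℝ) * Real.sigmoid ((1 - b i * inner ℝ (a i) x) / mu) ≤ 1 / (m : ℝ) :=
          mul_le_of_le_one_right (by positivity) h1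
        gcongr
    _ = 1 + gramNorm a b := by simp; field_simp

theorem hingeAvg_nonneg {mu : ℝ} (hmu : 0 < mu) (x : EuclideanSpace ℝ (Fin d)) :
    0 ≤ hingeAvg mu a b x :=
  mul_nonneg (by positivity) (Finset.sum_nonneg fun _ _ =>
    (le_max_left _ _).trans (max_le_shinge hmu _))

theorem hingeAvg_tangent {mu : ℝ} (hmu : 0 < mu) (x y : EuclideanSpace ℝ (Fin d)) :
    hingeAvg mu a b x + inner ℝ (hingeGrad mu a b x) (y - x) ≤ hingeAvg mu a b y := by
  rw [inner_hingeGrad, hingeAvg, hingeAvg, ← mul_add, ← Finset.sum_add_distrib]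
  refine mul_le_mul_of_nonneg_left (Finset.sum_le_sum fun i _ => ?_) (by positivity)
  refine le_trans (le_of_eq ?_) (shinge_tangent hmu (1 - b i * inner ℝ (a i) x) _)
  rw [inner_sub_right]; ring

theorem hingeAvg_upper {mu : ℝ} (hmu : 0 < mu) (x y : EuclideanSpace ℝ (Fin d)) :
    hingeAvg mu a b y ≤ hingeAvg mu a b x + inner ℝ (hingeGrad mu a b x) (y - x) +
      gramNorm a b / (m * mu) * ‖y - x‖ ^ 2 := by
  have h : ∑ i, shinge mu (1 - b i * inner ℝ (a i) y) ≤
      ∑ i, (shinge mu (1 - b i * inner ℝ (a i) x) +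
        Real.sigmoid ((1 - b i * inner ℝ (a i) x) / mu) * (-(b i * inner ℝ (a i) (y - x))) +
        mu⁻¹ * (b i * inner ℝ (a i) (y - x)) ^ 2) := by
    refine Finset.sum_le_sum fun i _ => ?_
    refine (shinge_upper hmu (1 - b i * inner ℝ (a i) x) _).trans (le_of_eq ?_)
    rw [inner_sub_right]; ring
  rw [Finset.sum_add_distrib, Finset.sum_add_distrib, ← Finset.mul_sum] at h
  have h1 := mul_le_mul_of_nonneg_left h (by positivity : 0 ≤ 1 / (m : ℝ))
  rw [inner_hingeGrad]
  refine h1.trans ?_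
  rw [mul_add, mul_add]
  refine add_le_add le_rfl ?_
  calc _ ≤ 1 / (m : ℝ) * (mu⁻¹ * (gramNorm a b * ‖y - x‖ ^ 2)) := by
        gcongr; exact sum_sq_inner_le_gramNorm a b (y - x)
    _ = _ := by rw [one_div, div_eq_mul_inv, mul_inv]; ring

theorem hasGradientAt_hingeAvg {mu : ℝ} (hmu : 0 < mu) (x : EuclideanSpace ℝ (Fin d)) :
    HasGradientAt (hingeAvg mu a b) (hingeGrad mu a b x) x := by
  rw [hasGradientAt_iff_hasFDerivAt]
  have h : ∀ i : Fin m, HasFDerivAt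
      (fun x : EuclideanSpace ℝ (Fin d) => shinge mu (1 - b i * inner ℝ (a i) x))
      (Real.sigmoid ((1 - b i * inner ℝ (a i) x) / mu) • (-(b i • innerSL ℝ (a i)))) x := by
    intro i
    have h1 : HasFDerivAt (fun x : EuclideanSpace ℝ (Fin d) => 1 - b i * inner ℝ (a i) x)
        (-(b i • innerSL ℝ (a i))) x :=
      (((innerSL ℝ (a i)).hasFDerivAt (x := x)).const_mul (b i)).const_sub 1
    exact (hasDerivAt_shinge hmu _).comp_hasFDerivAt x h1
  have h2 := (HasFDerivAt.fun_sum (u := Finset.univ) fun i _ => h i).const_mul (1 / (m : ℝ))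
  refine h2.congr_fderiv ?_
  ext v
  rw [InnerProductSpace.toDual_apply_apply, inner_hingeGrad]
  simp

end Average

/-! ### The quartic regularizer -/

/-- The coordinatewise cube, a quarter of the gradient of `‖x‖₄⁴`. -/
noncomputable def cube {d : ℕ} (x : EuclideanSpace ℝ (Fin d)) : EuclideanSpace ℝ (Fin d) :=
  WithLp.toLp 2 fun i => x i ^ 3

section Quartic

variable {d : ℕ}

theorem inner_cube (x v : EuclideanSpace ℝ (Fin d)) :
    inner ℝ (cube x) v = ∑ i, x i ^ 3 * v i := by
  simp only [cube, PiLp.inner_apply, RCLike.inner_apply, conj_trivial]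
  exact Finset.sum_congr rfl fun i _ => mul_comm _ _

theorem l4pow_nonneg (x : EuclideanSpace ℝ (Fin d)) : 0 ≤ l4pow x :=
  Finset.sum_nonneg fun i _ => by positivity

/-- Coordinatewise, with `δ = y - x`, the remainder `6x²δ² + 4xδ³ + δ⁴` minus `δ⁴/3` is `(2/3) δ²
(3x + δ)²`. This uniform convexity is the source of the growth at the minimizer. -/
theorem l4pow_tangent (x y : EuclideanSpace ℝ (Fin d)) :
    l4pow x + 4 * inner ℝ (cube x) (y - x) + 1 / 3 * l4pow (y - x) ≤ l4pow y := by
  rw [inner_cube, l4pow, l4pow, l4pow, Finset.mul_sum, Finset.mul_sum, ← Finset.sum_add_distrib,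
    ← Finset.sum_add_distrib]
  refine Finset.sum_le_sum fun i _ => ?_
  simp only [PiLp.sub_apply]
  have h : y i ^ 4 - (x i ^ 4 + 4 * (x i ^ 3 * (y i - x i)) + 1 / 3 * (y i - x i) ^ 4) =
      (y i - x i) ^ 2 * (2 / 3 * (3 * x i + (y i - x i)) ^ 2) := by ring
  have : 0 ≤ (y i - x i) ^ 2 * (2 / 3 * (3 * x i + (y i - x i)) ^ 2) := by positivity
  linarith

theorem l4pow_tangent' (x y : EuclideanSpace ℝ (Fin d)) :
    l4pow x + 4 * inner ℝ (cube x) (y - x) ≤ l4pow y := by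
  linarith [l4pow_tangent x y, l4pow_nonneg (y - x)]

theorem norm_pow_four_le (x : EuclideanSpace ℝ (Fin d)) : ‖x‖ ^ 4 ≤ d * l4pow x := by
  have h := sq_sum_le_card_mul_sum_sq (s := Finset.univ) (f := fun i => x i ^ 2)
  rw [show ‖x‖ ^ 4 = (‖x‖ ^ 2) ^ 2 by ring, EuclideanSpace.real_norm_sq_eq]
  simpa [l4pow, ← pow_mul] using h

theorem l4pow_le_norm_pow_four (x : EuclideanSpace ℝ (Fin d)) : l4pow x ≤ ‖x‖ ^ 4 := by
  have h := Finset.sum_sq_le_sq_sum_of_nonneg (s := Finset.univ) (f := fun i => x i ^ 2)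
    (fun i _ => sq_nonneg _)
  rw [show ‖x‖ ^ 4 = (‖x‖ ^ 2) ^ 2 by ring, EuclideanSpace.real_norm_sq_eq]
  simpa [l4pow, ← pow_mul] using h

theorem l4pow_combo (x y : EuclideanSpace ℝ (Fin d)) {t : ℝ} (h0 : 0 ≤ t) (h1 : t ≤ 1) :
    l4pow ((1 - t) • x + t • y) ≤ (1 - t) * l4pow x + t * l4pow y := by
  rw [l4pow, l4pow, l4pow, Finset.mul_sum, Finset.mul_sum, ← Finset.sum_add_distrib]
  refine Finset.sum_le_sum fun i _ => ?_
  have h := (Even.convexOn_pow (𝕜 := ℝ) (n := 4) (by decide)).2 (Set.mem_univ (x i))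
    (Set.mem_univ (y i)) (sub_nonneg.2 h1) h0 (by ring)
  simpa using h

theorem norm_cube_le {x : EuclideanSpace ℝ (Fin d)} {r : ℝ} (hr : 0 ≤ r) (h : l4pow x ≤ r ^ 4) :
    ‖cube x‖ ≤ r ^ 3 := by
  have h1 : ∀ i, x i ^ 2 ≤ r ^ 2 := by
    intro i
    have h2 : x i ^ 4 ≤ r ^ 4 := (Finset.single_le_sum (f := fun i => x i ^ 4)
      (fun i _ => by positivity) (Finset.mem_univ i)).trans h
    refine le_of_sq_le_sq ?_ (by positivity)
    nlinarith
  refine le_of_sq_le_sq ?_ (by positivity)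
  rw [EuclideanSpace.real_norm_sq_eq]
  calc ∑ i, (cube x).ofLp i ^ 2 ≤ ∑ i, r ^ 2 * x i ^ 4 := by
        refine Finset.sum_le_sum fun i _ => ?_
        have : (cube x).ofLp i ^ 2 = x i ^ 2 * x i ^ 4 := by simp only [cube]; ring
        rw [this]
        exact mul_le_mul_of_nonneg_right (h1 i) (by positivity)
    _ = r ^ 2 * l4pow x := by rw [l4pow, Finset.mul_sum]
    _ ≤ r ^ 2 * r ^ 4 := by gcongr
    _ = (r ^ 3) ^ 2 := by ring

theorem continuous_l4pow : Continuous (l4pow (d := d)) := by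
  unfold l4pow; fun_prop

theorem hasGradientAt_l4pow (x : EuclideanSpace ℝ (Fin d)) :
    HasGradientAt l4pow ((4 : ℝ) • cube x) x := by
  rw [hasGradientAt_iff_hasFDerivAt]
  have h : ∀ i : Fin d, HasFDerivAt (fun x : EuclideanSpace ℝ (Fin d) => x i ^ 4)
      ((4 * x i ^ 3) • (EuclideanSpace.proj i : EuclideanSpace ℝ (Fin d) →L[ℝ] ℝ)) x := by
    intro i
    have h1 : HasFDerivAt (fun x : EuclideanSpace ℝ (Fin d) => x i)
      (EuclideanSpace.proj i : EuclideanSpace ℝ (Fin d) →L[ℝ] ℝ) x :=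
      (EuclideanSpace.proj (𝕜 := ℝ) i).hasFDerivAt
    simpa using h1.pow 4
  have h2 := HasFDerivAt.fun_sum (u := Finset.univ) fun i _ => h i
  refine h2.congr_fderiv ?_
  ext v
  rw [InnerProductSpace.toDual_apply_apply, real_inner_smul_left, inner_cube, Finset.mul_sum]
  simp [mul_assoc]

theorem tendsto_l4pow_cocompact :
    Filter.Tendsto (l4pow (d := d)) (Filter.cocompact _) Filter.atTop := by
  rcases Nat.eq_zero_or_pos d with rfl | hd
  · simp [Filter.cocompact_eq_bot]
  have h1 : Filter.Tendsto (fun x : EuclideanSpace ℝ (Fin d) => ‖x‖ ^ 4 / d)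
      (Filter.cocompact _) Filter.atTop :=
    ((Filter.tendsto_pow_atTop (by norm_num)).comp
      tendsto_norm_cocompact_atTop).atTop_div_const (by exact_mod_cast hd)
  refine Filter.tendsto_atTop_mono (fun x => ?_) h1
  rw [div_le_iff₀ (by exact_mod_cast hd), mul_comm]
  exact norm_pow_four_le x

theorem exists_forall_quartic_add_le {lam : ℝ} (hlam : 0 < lam) {h : EuclideanSpace ℝ (Fin d) → ℝ}
    (hc : Continuous h) (h0 : ∀ x, 0 ≤ h x) :
    ∃ u, ∀ x, lam * l4pow u + h u ≤ lam * l4pow x + h x := by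
  refine Continuous.exists_forall_le (f := fun x => lam * l4pow x + h x)
    ((continuous_l4pow.const_mul lam).add hc) ?_
  refine Filter.tendsto_atTop_mono (fun x => ?_) (tendsto_l4pow_cocompact.const_mul_atTop hlam)
  linarith [h0 x]

theorem tendsto_pow_three_atBot :
    Filter.Tendsto (fun t : ℝ => t ^ 3) Filter.atBot Filter.atBot := by
  have h := Filter.tendsto_neg_atTop_atBot.comp ((Filter.tendsto_pow_atTop (α := ℝ)
    (n := 3) (by norm_num)).comp Filter.tendsto_neg_atBot_atTop)
  refine h.congr fun t => ?_
  simp only [Function.comp_apply]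
  ring

/-- The equation separates into scalar cubics, each onto by the intermediate value theorem. The case
`s = 0` is needed when the Gram matrix vanishes. -/
theorem exists_smul_cube_add_smul_eq {lam s : ℝ} (hlam : 0 < lam) (hs : 0 ≤ s)
    (v : EuclideanSpace ℝ (Fin d)) : ∃ z, (4 * lam) • cube z + s • z = v := by
  have h : Function.Surjective fun t : ℝ => 4 * lam * t ^ 3 + s * t := by
    refine Continuous.surjective (by fun_prop) ?_ ?_
    · refine Filter.tendsto_atTop_mono' Filter.atTop (f₁ := fun t : ℝ => 4 * lam * t ^ 3) ?_
        ((Filter.tendsto_pow_atTop (by norm_num)).const_mul_atTop (by positivity))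
      filter_upwards [Filter.eventually_ge_atTop 0] with t ht
      exact le_add_of_nonneg_right (mul_nonneg hs ht)
    · refine Filter.tendsto_atBot_mono' Filter.atBot (f₁ := fun t : ℝ => 4 * lam * t ^ 3) ?_
        (tendsto_pow_three_atBot.const_mul_atBot (by positivity))
      filter_upwards [Filter.eventually_le_atBot 0] with t ht
      exact add_le_of_nonpos_right (mul_nonpos_of_nonneg_of_nonpos hs ht)
  choose t ht using fun i => h (v i)
  refine ⟨WithLp.toLp 2 t, ?_⟩
  ext i
  simpa [cube] using ht i

/-- Lagrange multipliers: at the minimizer over `p + Sᗮ` the derivative vanishes along `Sᗮ`, so the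
quartic gradient lies in `Sᗮᗮ = S`. -/
theorem exists_l4pow_min_on_fiber (S : Submodule ℝ (EuclideanSpace ℝ (Fin d)))
    (p : EuclideanSpace ℝ (Fin d)) :
    ∃ x, x - p ∈ Sᗮ ∧ cube x ∈ S ∧ l4pow x ≤ l4pow p := by
  have hcl : IsClosed {x | x - p ∈ Sᗮ} :=
    Sᗮ.closed_of_finiteDimensional.preimage (continuous_id.sub continuous_const)
  have hp : p ∈ {x | x - p ∈ Sᗮ} := by simp
  obtain ⟨x, hx, hmin⟩ := continuous_l4pow.continuousOn.exists_isMinOn' hcl hp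
    ((tendsto_l4pow_cocompact.eventually_ge_atTop (l4pow p)).filter_mono inf_le_left)
  refine ⟨x, hx, ?_, hmin hp⟩
  rw [← Submodule.orthogonal_orthogonal S, Submodule.mem_orthogonal']
  intro v hv
  have h1 : IsLocalMin (fun t : ℝ => l4pow (x + t • v)) 0 := by
    refine Filter.Eventually.of_forall fun t => ?_
    simp only [zero_smul, add_zero]
    refine hmin ?_
    show x + t • v - p ∈ Sᗮ
    rw [add_sub_right_comm]
    exact Sᗮ.add_mem hx (Sᗮ.smul_mem t hv)
  have h2 : HasDerivAt (fun t : ℝ => x + t • v) v 0 := by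
    simpa using ((hasDerivAt_id (0 : ℝ)).smul_const v).const_add x
  have h3 : HasFDerivAt l4pow (InnerProductSpace.toDual ℝ _ ((4 : ℝ) • cube x))
      (x + (0 : ℝ) • v) := by
    simpa using (hasGradientAt_l4pow x).hasFDerivAt
  have h4 := h1.hasDerivAt_eq_zero
    (HasFDerivAt.comp_hasDerivAt (f := fun t : ℝ => x + t • v) (l := l4pow) 0 h3 h2)
  rw [InnerProductSpace.toDual_apply_apply, real_inner_smul_left] at h4
  linarith

end Quartic

/-! ### Restarted accelerated proximal gradient method -/

section Accelerated

variable {d : ℕ}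

/-- The resolvent of the quartic: a solution `z` of `4λ z³ + s z = v`. -/
noncomputable def quarticProx (lam s : ℝ) (v : EuclideanSpace ℝ (Fin d)) :
    EuclideanSpace ℝ (Fin d) :=
  Classical.epsilon fun z => (4 * lam) • cube z + s • z = v

theorem quarticProx_spec {lam s : ℝ} (hlam : 0 < lam) (hs : 0 ≤ s)
    (v : EuclideanSpace ℝ (Fin d)) :
    (4 * lam) • cube (quarticProx lam s v) + s • quarticProx lam s v = v :=
  Classical.epsilon_spec (exists_smul_cube_add_smul_eq hlam hs v)

/-- The memory of the accelerated method: the number of steps since the last restart, the current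
point, the current mirror point, and the point of the last restart. -/
structure AccelState (d : ℕ) where
  /-- the number of steps since the last restart -/
  count : ℕ
  /-- the current point -/
  pt : EuclideanSpace ℝ (Fin d)
  /-- the current mirror point -/
  mirror : EuclideanSpace ℝ (Fin d)
  /-- the point of the last restart -/
  base : EuclideanSpace ℝ (Fin d)

/-- The state at a restart from the point `p`. -/
def AccelState.restart (p : EuclideanSpace ℝ (Fin d)) : AccelState d := ⟨0, p, p, p⟩

/-- The step size `2 / (k + 2)`. -/
noncomputable def AccelState.theta (s : AccelState d) : ℝ := 2 / (s.count + 2)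

/-- The point at which the gradient is queried. -/
noncomputable def AccelState.probe (s : AccelState d) : EuclideanSpace ℝ (Fin d) :=
  (1 - s.theta) • s.pt + s.theta • s.mirror

/-- The next mirror point, where `v` is the gradient of the objective at the probe. -/
noncomputable def AccelState.nextMirror (lam L : ℝ) (s : AccelState d)
    (v : EuclideanSpace ℝ (Fin d)) : EuclideanSpace ℝ (Fin d) :=
  quarticProx lam (s.theta * L) ((s.theta * L) • s.mirror - (v - (4 * lam) • cube s.probe))

/-- The next point. -/
noncomputable def AccelState.nextPt (lam L : ℝ) (s : AccelState d)
    (v : EuclideanSpace ℝ (Fin d)) : EuclideanSpace ℝ (Fin d) :=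
  (1 - s.theta) • s.pt + s.theta • s.nextMirror lam L v

/-- The state after a step, where `v` is the gradient of the objective at the probe. -/
noncomputable def AccelState.next (lam L : ℝ) (T : ℕ) (s : AccelState d)
    (v : EuclideanSpace ℝ (Fin d)) : AccelState d :=
  if s.count + 1 = T then .restart (s.nextPt lam L v)
  else ⟨s.count + 1, s.nextPt lam L v, s.nextMirror lam L v, s.base⟩

/-- One step of the accelerated method for an objective with gradient `G`. -/
noncomputable def AccelState.micro (lam L : ℝ) (T : ℕ)
    (G : EuclideanSpace ℝ (Fin d) → EuclideanSpace ℝ (Fin d)) (s : AccelState d) : AccelState d :=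
  s.next lam L T (G s.probe)

/-- The accelerated proximal gradient method for `λ‖x‖₄⁴ + h(x)` with `h` an `L`-smooth convex
function, restarted every `T` steps. -/
noncomputable def accelMachine (d : ℕ) (lam L : ℝ) (T : ℕ) : GradMachine d where
  Mem := AccelState d
  start := .restart 0
  query := AccelState.probe
  update := AccelState.next lam L T
  output := AccelState.base

variable {lam L : ℝ} {h : EuclideanSpace ℝ (Fin d) → ℝ}
  {g : EuclideanSpace ℝ (Fin d) → EuclideanSpace ℝ (Fin d)}

/-- The hypothesis `hz` is the optimality condition of `λ‖·‖₄⁴ + ⟪w, ·⟫ + (s/2)‖· - z‖²` at `z'`;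
the term `(s/2)‖z' - u‖²` is the gain from strong convexity. -/
theorem quarticProx_three_point {z z' w u : EuclideanSpace ℝ (Fin d)} {s : ℝ} (hlam : 0 < lam)
    (hz : (4 * lam) • cube z' + s • z' = s • z - w) :
    lam * l4pow z' + inner ℝ w (z' - u) + s / 2 * ‖z' - z‖ ^ 2 + s / 2 * ‖z' - u‖ ^ 2 ≤
      lam * l4pow u + s / 2 * ‖z - u‖ ^ 2 := by
  have h1 := mul_le_mul_of_nonneg_left (l4pow_tangent' z' u) hlam.le
  have h2 : w = -((4 * lam) • cube z') - s • (z' - z) := by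
    rw [smul_sub, eq_sub_iff_add_eq, eq_neg_iff_add_eq_zero]
    have : w = s • z - ((4 * lam) • cube z' + s • z') := by rw [hz]; abel
    rw [this]; abel
  have h3 : ‖z - u‖ ^ 2 = ‖z' - u‖ ^ 2 - 2 * inner ℝ (z' - z) (z' - u) + ‖z' - z‖ ^ 2 := by
    rw [show z - u = (z' - u) - (z' - z) by abel, norm_sub_sq_real, real_inner_comm]
  rw [h2, inner_sub_left, inner_neg_left, real_inner_smul_left, real_inner_smul_left, h3]
  have h4 : inner ℝ (cube z') (u - z') = -inner ℝ (cube z') (z' - u) := by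
    rw [← inner_neg_right, neg_sub]
  rw [h4] at h1
  linarith

theorem AccelState.step_bound (hlam : 0 < lam) (hL : 0 ≤ L)
    (ht : ∀ x y, h x + inner ℝ (g x) (y - x) ≤ h y)
    (hu : ∀ x y, h y ≤ h x + inner ℝ (g x) (y - x) + L / 2 * ‖y - x‖ ^ 2)
    (s : AccelState d) (u : EuclideanSpace ℝ (Fin d)) {v : EuclideanSpace ℝ (Fin d)}
    (hv : v = (4 * lam) • cube s.probe + g s.probe) :
    lam * l4pow (s.nextPt lam L v) + h (s.nextPt lam L v) +
        s.theta ^ 2 * (L / 2) * ‖s.nextMirror lam L v - u‖ ^ 2 ≤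
      (1 - s.theta) * (lam * l4pow s.pt + h s.pt) + s.theta * (lam * l4pow u + h u) +
        s.theta ^ 2 * (L / 2) * ‖s.mirror - u‖ ^ 2 := by
  have hth0 : 0 ≤ s.theta := by unfold AccelState.theta; positivity
  have hth1 : s.theta ≤ 1 := by
    unfold AccelState.theta; rw [div_le_one (by positivity)]; linarith [s.count.cast_nonneg (α := ℝ)]
  have hz := quarticProx_spec hlam (mul_nonneg hth0 hL)
    ((s.theta * L) • s.mirror - (v - (4 * lam) • cube s.probe))
  change (4 * lam) • cube (s.nextMirror lam L v) + (s.theta * L) • (s.nextMirror lam L v) = _ at hz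
  have hw : v - (4 * lam) • cube s.probe = g s.probe := by rw [hv]; abel
  rw [hw] at hz
  have hx' : s.nextPt lam L v = (1 - s.theta) • s.pt + s.theta • s.nextMirror lam L v := rfl
  have hy' : s.probe = (1 - s.theta) • s.pt + s.theta • s.mirror := rfl
  generalize s.nextPt lam L v = x' at *
  generalize s.nextMirror lam L v = z' at *
  generalize s.probe = y at *
  generalize s.theta = th at *
  generalize s.pt = x at *
  generalize s.mirror = z at *
  have h3 := quarticProx_three_point (u := u) hlam hz
  -- This makes the smoothness error `(L/2) θ² ‖z' - z‖²`, exactly what `θ` times the three-point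
  -- inequality with `s = θL` cancels. The second decomposition distributes the linear term over the
  -- convex combination.
  have e1 : x' - y = th • (z' - z) := by rw [hx', hy', smul_sub]; abel
  have e2 : x' - y = (1 - th) • (x - y) + th • (z' - y) := by
    rw [hx', smul_sub, smul_sub, sub_smul, sub_smul, one_smul, one_smul]; abel
  have h4 := hu y x'
  rw [show ‖x' - y‖ ^ 2 = th ^ 2 * ‖z' - z‖ ^ 2 by
    rw [e1, norm_smul, mul_pow, Real.norm_eq_abs, sq_abs], e2, inner_add_right,
    real_inner_smul_right, real_inner_smul_right] at h4
  have h5 := mul_le_mul_of_nonneg_left (l4pow_combo x z' hth0 hth1) hlam.le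
  rw [← hx'] at h5
  have h6 := mul_le_mul_of_nonneg_left (ht y x) (sub_nonneg.2 hth1)
  have h7 := mul_le_mul_of_nonneg_left (ht y u) hth0
  have h8 := mul_le_mul_of_nonneg_left h3 hth0
  have e3 : inner ℝ (g y) (z' - u) = inner ℝ (g y) (z' - y) - inner ℝ (g y) (u - y) := by
    rw [← inner_sub_right]; congr 1; abel
  rw [e3] at h8
  linarith

/-- The bound that holds `i` steps after a restart from `p`. -/
def AccelState.PhaseBound (F : EuclideanSpace ℝ (Fin d) → ℝ) (L : ℝ)
    (p u x z : EuclideanSpace ℝ (Fin d)) (i : ℕ) : Prop :=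
  (i : ℝ) * (i + 2) / 4 * (F x - F u) + L / 2 * ‖z - u‖ ^ 2 ≤ L / 2 * ‖p - u‖ ^ 2

/-- Divide the one-step bound by `θ² = 4/(k+2)²`: the old gap then has weight `k(k+2)/4` and the new
one `(k+2)²/4`. Since the gap is nonnegative, the latter may be lowered to `(k+1)(k+3)/4`, which
closes the induction. -/
theorem AccelState.phaseBound_succ {F : EuclideanSpace ℝ (Fin d) → ℝ}
    (hF : ∀ x, F x = lam * l4pow x + h x) (hlam : 0 < lam) (hL : 0 ≤ L)
    (ht : ∀ x y, h x + inner ℝ (g x) (y - x) ≤ h y)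
    (hu : ∀ x y, h y ≤ h x + inner ℝ (g x) (y - x) + L / 2 * ‖y - x‖ ^ 2)
    {u : EuclideanSpace ℝ (Fin d)} (hmin : ∀ x, F u ≤ F x)
    (s : AccelState d) {v : EuclideanSpace ℝ (Fin d)} {p : EuclideanSpace ℝ (Fin d)}
    (hv : v = (4 * lam) • cube s.probe + g s.probe)
    (hs : AccelState.PhaseBound F L p u s.pt s.mirror s.count) :
    AccelState.PhaseBound F L p u (s.nextPt lam L v) (s.nextMirror lam L v) (s.count + 1) := by
  have h1 := s.step_bound hlam hL ht hu u hv
  rw [← hF, ← hF, ← hF] at h1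
  unfold AccelState.PhaseBound at hs ⊢
  have hth : s.theta * (s.count + 2) = 2 := by
    unfold AccelState.theta; field_simp
  have hk : (0 : ℝ) ≤ s.count := s.count.cast_nonneg
  push_cast
  generalize (s.count : ℝ) = k at *
  generalize s.theta = th at *
  have e : th = 2 / (k + 2) := by rw [eq_div_iff (by positivity)]; exact hth
  subst e
  have h2 := mul_le_mul_of_nonneg_left h1 (by positivity : 0 ≤ (k + 2) ^ 2 / 4)
  have e1 : ∀ t : ℝ, (k + 2) ^ 2 / 4 * ((2 / (k + 2)) ^ 2 * (L / 2) * t) = L / 2 * t := by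
    intro t; field_simp; ring
  have e2 : (k + 2) ^ 2 / 4 * ((1 - 2 / (k + 2)) * F s.pt + 2 / (k + 2) * F u) =
      k * (k + 2) / 4 * (F s.pt - F u) + (k + 2) ^ 2 / 4 * F u := by
    field_simp; ring
  rw [mul_add, mul_add, e1, e1, e2] at h2
  have h3 : 0 ≤ F (s.nextPt lam L v) - F u := sub_nonneg.2 (hmin _)
  nlinarith

theorem accelMachine_phase {F : EuclideanSpace ℝ (Fin d) → ℝ}
    (hF : ∀ x, F x = lam * l4pow x + h x) (hlam : 0 < lam) (hL : 0 ≤ L)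
    (ht : ∀ x y, h x + inner ℝ (g x) (y - x) ≤ h y)
    (hu : ∀ x y, h y ≤ h x + inner ℝ (g x) (y - x) + L / 2 * ‖y - x‖ ^ 2)
    {u : EuclideanSpace ℝ (Fin d)} (hmin : ∀ x, F u ≤ F x)
    (hg : ∀ x, gradient F x = (4 * lam) • cube x + g x) (T : ℕ) (p : EuclideanSpace ℝ (Fin d))
    (i : ℕ) (hi : i < T) :
    ∃ s : AccelState d, (AccelState.micro lam L T (gradient F))^[i] (.restart p) = s ∧
      s.count = i ∧ s.base = p ∧ AccelState.PhaseBound F L p u s.pt s.mirror i := by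
  induction i with
  | zero => exact ⟨_, rfl, rfl, rfl, by
    simp only [AccelState.PhaseBound, AccelState.restart]; simp⟩
  | succ i ih =>
    obtain ⟨s, hs, hc, hb, hP⟩ := ih (by omega)
    refine ⟨⟨s.count + 1, s.nextPt lam L (gradient F s.probe),
      s.nextMirror lam L (gradient F s.probe), s.base⟩, ?_, by rw [hc], hb, ?_⟩
    · rw [Function.iterate_succ_apply', hs]
      exact if_neg (by omega)
    · subst hc
      exact AccelState.phaseBound_succ hF hlam hL ht hu hmin s (hg _) hP

theorem accelMachine_restart {F : EuclideanSpace ℝ (Fin d) → ℝ}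
    (hF : ∀ x, F x = lam * l4pow x + h x) (hlam : 0 < lam) (hL : 0 ≤ L)
    (ht : ∀ x y, h x + inner ℝ (g x) (y - x) ≤ h y)
    (hu : ∀ x y, h y ≤ h x + inner ℝ (g x) (y - x) + L / 2 * ‖y - x‖ ^ 2)
    {u : EuclideanSpace ℝ (Fin d)} (hmin : ∀ x, F u ≤ F x)
    (hg : ∀ x, gradient F x = (4 * lam) • cube x + g x) {T : ℕ} (hT : 0 < T)
    (p : EuclideanSpace ℝ (Fin d)) :
    ∃ x, (AccelState.micro lam L T (gradient F))^[T] (.restart p) = .restart x ∧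
      (T : ℝ) ^ 2 * (F x - F u) ≤ 2 * L * ‖p - u‖ ^ 2 := by
  obtain ⟨s, hs, hc, hb, hP⟩ :=
    accelMachine_phase hF hlam hL ht hu hmin hg T p (T - 1) (by omega)
  refine ⟨s.nextPt lam L (gradient F s.probe), ?_, ?_⟩
  · have h1 : (AccelState.micro lam L T (gradient F))^[T - 1 + 1] (.restart p) =
        .restart (s.nextPt lam L (gradient F s.probe)) := by
      rw [Function.iterate_succ_apply', hs]
      exact if_pos (by omega)
    rwa [Nat.sub_add_cancel hT] at h1
  · rw [← hc] at hP
    have h1 := AccelState.phaseBound_succ hF hlam hL ht hu hmin s (hg _) hP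
    rw [hc, Nat.sub_add_cancel hT] at h1
    unfold AccelState.PhaseBound at h1
    have h2 : 0 ≤ F (s.nextPt lam L (gradient F s.probe)) - F u := sub_nonneg.2 (hmin _)
    have h3 : 0 ≤ L / 2 * ‖s.nextMirror lam L (gradient F s.probe) - u‖ ^ 2 := by positivity
    have h4 : 0 ≤ (T : ℝ) * (F (s.nextPt lam L (gradient F s.probe)) - F u) := by positivity
    nlinarith

/-- The growth of `λ‖x‖₄⁴ + h(x)` away from its minimizer. -/
theorem norm_sub_pow_four_le {F : EuclideanSpace ℝ (Fin d) → ℝ}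
    (hF : ∀ x, F x = lam * l4pow x + h x) (hlam : 0 < lam)
    (ht : ∀ x y, h x + inner ℝ (g x) (y - x) ≤ h y)
    {u : EuclideanSpace ℝ (Fin d)} (hg : (4 * lam) • cube u + g u = 0)
    (p : EuclideanSpace ℝ (Fin d)) : lam * ‖p - u‖ ^ 4 ≤ 3 * d * (F p - F u) := by
  have h1 := mul_le_mul_of_nonneg_left (l4pow_tangent u p) hlam.le
  have h2 := ht u p
  have h3 : 4 * lam * inner ℝ (cube u) (p - u) + inner ℝ (g u) (p - u) = 0 := by
    rw [← real_inner_smul_left, ← inner_add_left, hg, inner_zero_left]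
  have h4 : lam * l4pow (p - u) ≤ 3 * (F p - F u) := by rw [hF, hF]; linarith
  have h5 := mul_le_mul_of_nonneg_left (norm_pow_four_le (p - u)) hlam.le
  have h6 := mul_le_mul_of_nonneg_left h4 (Nat.cast_nonneg (α := ℝ) d)
  linarith

/-- Quartic growth turns a gap `γ` into a distance bound, and a phase of length `T` turns the
distance into a gap of at most `γ/2` as long as `γ ≥ ε/2`. Because the output is the last restart
point, the bound holds at every time, with the number of completed phases as exponent. -/
theorem accelMachine_gap {F : EuclideanSpace ℝ (Fin d) → ℝ}
    (hF : ∀ x, F x = lam * l4pow x + h x) (hlam : 0 < lam) (hL : 0 ≤ L)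
    (ht : ∀ x y, h x + inner ℝ (g x) (y - x) ≤ h y)
    (hu : ∀ x y, h y ≤ h x + inner ℝ (g x) (y - x) + L / 2 * ‖y - x‖ ^ 2)
    {u : EuclideanSpace ℝ (Fin d)} (hmin : ∀ x, F u ≤ F x)
    (hgu : (4 * lam) • cube u + g u = 0)
    (hg : ∀ x, gradient F x = (4 * lam) • cube x + g x) {T : ℕ} (hT : 0 < T)
    {eps : ℝ} (heps : 0 < eps) (hTL : 96 * L ^ 2 * d ≤ lam * eps * T ^ 4)
    {D : ℝ} (h0 : F 0 - F u ≤ D) (t : ℕ) :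
    F ((accelMachine d lam L T).output
      (((accelMachine d lam L T).micro (gradient F))^[t] (accelMachine d lam L T).start)) - F u ≤
      max (D * (1 / 2) ^ (t / T)) (eps / 2) := by
  have hT' : (0 : ℝ) < T := by exact_mod_cast hT
  have hphase : ∀ j : ℕ, ∃ x, (AccelState.micro lam L T (gradient F))^[T * j]
      (AccelState.restart 0) = .restart x ∧ F x - F u ≤ max (D * (1 / 2) ^ j) (eps / 2) := by
    intro j
    induction j with
    | zero => exact ⟨0, rfl, by simp [h0]⟩
    | succ j ih =>
      obtain ⟨p, hp, hgap⟩ := ih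
      obtain ⟨x, hx, hb⟩ := accelMachine_restart hF hlam hL ht hu hmin hg hT p
      refine ⟨x, by rw [Nat.mul_succ, Nat.add_comm, Function.iterate_add_apply, hp, hx], ?_⟩
      have hR := norm_sub_pow_four_le hF hlam ht hgu p
      set γ := max (D * (1 / 2) ^ j) (eps / 2) with hγ
      have hγe : eps / 2 ≤ γ := le_max_right _ _
      have hγ0 : 0 < γ := by linarith
      have h1 : lam * ‖p - u‖ ^ 4 ≤ 3 * d * γ := hR.trans (by gcongr)
      -- The growth bound controls a fourth power, so the inequality is squared; `γ ≥ ε/2` then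
      -- makes `hTL` applicable.
      have h2 : 4 * L * ‖p - u‖ ^ 2 ≤ γ * T ^ 2 := by
        refine le_of_sq_le_sq ?_ (by positivity)
        refine le_of_mul_le_mul_left ?_ hlam
        calc lam * (4 * L * ‖p - u‖ ^ 2) ^ 2 = 16 * L ^ 2 * (lam * ‖p - u‖ ^ 4) := by ring
          _ ≤ 16 * L ^ 2 * (3 * d * γ) := by gcongr
          _ = γ * (1 / 2 * (96 * L ^ 2 * d)) := by ring
          _ ≤ γ * (1 / 2 * (lam * eps * T ^ 4)) := by gcongr
          _ = γ * (lam * (eps / 2) * T ^ 4) := by ring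
          _ ≤ γ * (lam * γ * T ^ 4) := by gcongr
          _ = lam * (γ * T ^ 2) ^ 2 := by ring
      have h3 : F x - F u ≤ γ / 2 := by
        refine le_of_mul_le_mul_left ?_ (by positivity : (0 : ℝ) < T ^ 2)
        linarith
      refine h3.trans ?_
      rcases max_choice (D * (1 / 2) ^ j) (eps / 2) with h4 | h4
      · rw [hγ, h4, pow_succ]
        exact le_max_of_le_left (by linarith)
      · rw [hγ, h4]
        exact le_max_of_le_right (by linarith)
  obtain ⟨p, hp, hgap⟩ := hphase (t / T)
  obtain ⟨s, hs, -, hb, -⟩ := accelMachine_phase hF hlam hL ht hu hmin hg T p (t % T)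
    (Nat.mod_lt _ hT)
  have he : (AccelState.micro lam L T (gradient F))^[t] (.restart 0) = s := by
    conv_lhs => rw [← Nat.mod_add_div t T, Function.iterate_add_apply]
    rw [hp, hs]
  change F ((AccelState.micro lam L T (gradient F))^[t] (.restart 0)).base - F u ≤ _
  rw [he, hb]
  exact hgap

end Accelerated

/-! ### Optimality certificates from gradients alone -/

section Certificate

variable {E : Type*} [NormedAddCommGroup E] [InnerProductSpace ℝ E]

/-- A theorem of the alternative for finitely many affine cuts on a compact convex set. -/
theorem exists_cut_weights {ι : Type*} [Fintype ι] {K : Set E} (hK : Convex ℝ K)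
    (hKc : IsCompact K) (hKn : K.Nonempty) (x G : ι → E) (c : ℝ)
    (hcut : ∀ z ∈ K, ∃ k, inner ℝ (G k) (x k - z) < c) :
    ∃ w : ι → ℝ, (∀ k, 0 ≤ w k) ∧ ∑ k, w k = 1 ∧
      ∀ z ∈ K, ∑ k, w k * inner ℝ (G k) (x k - z) ≤ c := by
  classical
  let φ : E → ι → ℝ := fun z k => inner ℝ (G k) (x k - z)
  have hφ : Continuous φ := by
    refine continuous_pi fun k => ?_
    exact continuous_const.inner (continuous_const.sub continuous_id)
  -- The vector of cut values is affine in `z`, so its image is compact and convex. It misses the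
  -- orthant of vectors that are at least `c` in every entry, and the separating functional supplies
  -- the weights.
  have hconv : Convex ℝ (φ '' K) := by
    rintro _ ⟨z₁, h₁, rfl⟩ _ ⟨z₂, h₂, rfl⟩ s t hs ht hst
    refine ⟨s • z₁ + t • z₂, hK h₁ h₂ hs ht hst, ?_⟩
    funext k
    simp only [φ, inner_sub_right, inner_add_right, real_inner_smul_right, Pi.add_apply,
      Pi.smul_apply, smul_eq_mul]
    linear_combination -inner ℝ (G k) (x k) * hst
  have hdisj : Disjoint (φ '' K) (Set.Ici fun _ => c) := by
    rw [Set.disjoint_left]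
    rintro _ ⟨z, hz, rfl⟩ hc
    obtain ⟨k, hk⟩ := hcut z hz
    exact absurd (hc k) (not_le.2 hk)
  obtain ⟨f, u, v, hu, huv, hv⟩ := geometric_hahn_banach_compact_closed hconv (hKc.image hφ)
    (convex_Ici _) isClosed_Ici hdisj
  have hf : ∀ y : ι → ℝ, f y = ∑ k, f (Pi.single k 1) * y k := by
    intro y
    conv_lhs => rw [← Finset.univ_sum_single y, map_sum]
    refine Finset.sum_congr rfl fun k _ => ?_
    rw [show Pi.single k (y k) = y k • (Pi.single k 1 : ι → ℝ) by
      rw [← Pi.single_smul, smul_eq_mul, mul_one], map_smul, smul_eq_mul, mul_comm]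
  have hpos : ∀ k, 0 ≤ f (Pi.single k 1) := by
    intro k
    by_contra! hneg
    -- A negative weight would make the functional unbounded below along a ray of the orthant.
    obtain ⟨n, hn⟩ := exists_nat_gt ((f (fun _ => c) - v) / -f (Pi.single k 1))
    have h1 := hv ((fun _ => c) + (n : ℝ) • Pi.single k 1) (by
      intro j
      have : (0 : ℝ) ≤ (n : ℝ) * (Pi.single k 1 : ι → ℝ) j :=
        mul_nonneg n.cast_nonneg (by by_cases h : j = k <;> simp [h])
      simpa using this)
    rw [map_add, map_smul, smul_eq_mul] at h1
    rw [div_lt_iff₀ (by linarith)] at hn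
    linarith
  set W := ∑ k, f (Pi.single k 1) with hW
  have hc : f (fun _ => c) = c * W := by rw [hf, ← Finset.sum_mul, mul_comm]
  have hlt : ∀ z ∈ K, ∑ k, f (Pi.single k 1) * inner ℝ (G k) (x k - z) < c * W := by
    intro z hz
    have h1 := hu (φ z) ⟨z, hz, rfl⟩
    rw [hf] at h1
    have h2 := hv (fun _ => c) (Set.self_mem_Ici)
    rw [hc] at h2
    exact h1.trans (huv.trans h2)
  have hW0 : 0 < W := by
    refine lt_of_le_of_ne (Finset.sum_nonneg fun k _ => hpos k) fun h0 => ?_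
    obtain ⟨z, hz⟩ := hKn
    have h1 := hlt z hz
    have h2 : ∀ k, f (Pi.single k 1) = 0 := fun k =>
      (Finset.sum_eq_zero_iff_of_nonneg fun k _ => hpos k).1 h0.symm k (Finset.mem_univ k)
    simp [← h0, h2] at h1
  refine ⟨fun k => f (Pi.single k 1) / W, fun k => div_nonneg (hpos k) hW0.le, ?_, fun z hz => ?_⟩
  · rw [← Finset.sum_div, ← hW, div_self hW0.ne']
  · simp only [div_mul_eq_mul_div]
    rw [← Finset.sum_div, div_le_iff₀ hW0]
    exact (hlt z hz).le

/-- `xh` is a convex combination of the query points in `hist` whose suboptimality over the ball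
of radius `R` is certified to be at most `c` by the answers in `hist`. -/
def IsCertified (R c : ℝ) (hist : List (E × E)) (xh : E) : Prop :=
  ∃ w : Fin hist.length → ℝ, (∀ k, 0 ≤ w k) ∧ ∑ k, w k = 1 ∧
    xh = ∑ k, w k • (hist.get k).1 ∧
    ∀ z, ‖z‖ ≤ R → ∑ k, w k * inner ℝ (hist.get k).2 ((hist.get k).1 - z) ≤ c

theorem exists_isCertified [FiniteDimensional ℝ E] {R c : ℝ} (hR : 0 ≤ R) {hist : List (E × E)}
    (hcut : ∀ z, ‖z‖ ≤ R → ∃ e ∈ hist, inner ℝ e.2 (e.1 - z) < c) :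
    ∃ xh, IsCertified R c hist xh := by
  have : ProperSpace E := FiniteDimensional.proper ℝ E
  obtain ⟨w, h0, h1, h2⟩ := exists_cut_weights (K := Metric.closedBall (0 : E) R)
    (convex_closedBall _ _) (isCompact_closedBall _ _) ⟨0, by simpa using hR⟩
    (fun k : Fin hist.length => (hist.get k).1) (fun k => (hist.get k).2) c (by
      intro z hz
      obtain ⟨e, he, hlt⟩ := hcut z (by simpa using hz)
      obtain ⟨k, rfl⟩ := List.get_of_mem he
      exact ⟨k, hlt⟩)
  exact ⟨_, w, h0, h1, rfl, fun z hz => h2 z (by simpa using hz)⟩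

/-- Jensen at the convex combination, then each query value compared with `F z` by its tangent
inequality. No function value has to be known. -/
theorem IsCertified.le {F : E → ℝ} {F' : E → E}
    (hF : ∀ x y, F x + inner ℝ (F' x) (y - x) ≤ F y) {R c : ℝ} {hist : List (E × E)}
    (hhist : ∀ e ∈ hist, e.2 = F' e.1) {xh : E} (h : IsCertified R c hist xh) {z : E}
    (hz : ‖z‖ ≤ R) : F xh ≤ F z + c := by
  obtain ⟨w, h0, h1, rfl, h2⟩ := h
  set xh := ∑ k, w k • (hist.get k).1 with hxh
  have h3 : F xh ≤ ∑ k, w k * F (hist.get k).1 := by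
    have h4 : ∑ k, w k * (F xh + inner ℝ (F' xh) ((hist.get k).1 - xh)) ≤
        ∑ k, w k * F (hist.get k).1 :=
      Finset.sum_le_sum fun k _ => mul_le_mul_of_nonneg_left (hF _ _) (h0 k)
    refine le_trans (le_of_eq ?_) h4
    simp only [mul_add, inner_sub_right, mul_sub, Finset.sum_add_distrib, Finset.sum_sub_distrib,
      ← Finset.sum_mul, h1, one_mul]
    rw [hxh]
    simp only [inner_sum, real_inner_smul_right]
    ring
  have h5 : ∑ k, w k * F (hist.get k).1 ≤
      ∑ k, (w k * F z + w k * inner ℝ (hist.get k).2 ((hist.get k).1 - z)) := by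
    refine Finset.sum_le_sum fun k _ => ?_
    rw [← mul_add]
    refine mul_le_mul_of_nonneg_left ?_ (h0 k)
    have h6 := hF (hist.get k).1 z
    rw [← hhist _ (List.get_mem _ _), ← neg_sub, inner_neg_right] at h6
    linarith
  rw [Finset.sum_add_distrib, ← Finset.sum_mul, h1, one_mul] at h5
  linarith [h2 z hz]

end Certificate

/-! ### Ellipsoids with cuts from a low-dimensional space -/

section Ellipsoid

variable {d : ℕ}

/-- The ellipsoid `{z | ⟪B (z - c), z - c⟫ ≤ s}`. -/
structure Ellipsoid (d : ℕ) where
  /-- the quadratic form -/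
  form : EuclideanSpace ℝ (Fin d) →ₗ[ℝ] EuclideanSpace ℝ (Fin d)
  /-- the centre -/
  centre : EuclideanSpace ℝ (Fin d)
  /-- the size -/
  size : ℝ

namespace Ellipsoid

/-- The set of points of an ellipsoid. -/
def Contains (P : Ellipsoid d) (z : EuclideanSpace ℝ (Fin d)) : Prop :=
  inner ℝ (P.form (z - P.centre)) (z - P.centre) ≤ P.size

/-- The ball with centre `0` and radius `κ^(-1/2)`. -/
def ball (d : ℕ) (κ : ℝ) : Ellipsoid d := ⟨κ • LinearMap.id, 0, 1⟩

/-- The preimage of a vector under the quadratic form. -/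
noncomputable def preimage (P : Ellipsoid d) (g : EuclideanSpace ℝ (Fin d)) :
    EuclideanSpace ℝ (Fin d) :=
  Classical.epsilon fun u => P.form u = g

/-- The ellipsoid of the central cut `⟪g, z - c⟫ ≤ 0` in the ellipsoid method for
dimension `m + 1`. -/
noncomputable def cut (m : ℕ) (P : Ellipsoid d) (g : EuclideanSpace ℝ (Fin d)) : Ellipsoid d where
  form := P.form + (2 / (m * inner ℝ g (P.preimage g))) • (innerₛₗ ℝ g).smulRight g
  centre := P.centre -
    (Real.sqrt (P.size / inner ℝ g (P.preimage g)) / (m + 2)) • P.preimage g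
  size := (m + 1) ^ 2 / (m * (m + 2)) * P.size

/-- The invariants of the ellipsoid method after `j` cuts with directions in `V`. -/
structure Valid (m : ℕ) (V : Submodule ℝ (EuclideanSpace ℝ (Fin d))) (κ : ℝ) (j : ℕ)
    (P : Ellipsoid d) : Prop where
  symm : P.form.IsSymmetric
  lower : ∀ x, κ * ‖x‖ ^ 2 ≤ inner ℝ (P.form x) x
  range : ∀ x, P.form x - κ • x ∈ V
  det : LinearMap.det P.form = κ ^ d * ((m + 2 : ℝ) / m) ^ j
  size : P.size = ((m + 1 : ℝ) ^ 2 / (m * (m + 2))) ^ j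

theorem valid_ball (m : ℕ) (V : Submodule ℝ (EuclideanSpace ℝ (Fin d))) (κ : ℝ) :
    (ball d κ).Valid m V κ 0 where
  symm x y := by simp [ball, real_inner_smul_left, real_inner_smul_right]
  lower x := by simp [ball, real_inner_smul_left]
  range x := by simp [ball]
  det := by simp [ball, LinearMap.det_smul]
  size := by simp [ball]

theorem contains_ball {κ : ℝ} {z : EuclideanSpace ℝ (Fin d)} (h : κ * ‖z‖ ^ 2 ≤ 1) :
    (ball d κ).Contains z := by
  simpa [Contains, ball, real_inner_smul_left] using h

variable {m : ℕ} {V : Submodule ℝ (EuclideanSpace ℝ (Fin d))} {κ : ℝ} {j : ℕ} {P : Ellipsoid d}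

theorem Valid.form_preimage (hP : P.Valid m V κ j) (hκ : 0 < κ) (g : EuclideanSpace ℝ (Fin d)) :
    P.form (P.preimage g) = g := by
  have hinj : Function.Injective P.form := by
    rw [← LinearMap.ker_eq_bot, LinearMap.ker_eq_bot']
    intro x hx
    have h := hP.lower x
    rw [hx, inner_zero_left] at h
    have h1 : ‖x‖ ^ 2 ≤ 0 := by nlinarith
    exact norm_eq_zero.1 (pow_eq_zero_iff two_ne_zero |>.1 (le_antisymm h1 (sq_nonneg _)))
  exact Classical.epsilon_spec (LinearMap.surjective_of_injective hinj g)

theorem Valid.inner_preimage_pos (hP : P.Valid m V κ j) (hκ : 0 < κ)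
    {g : EuclideanSpace ℝ (Fin d)} (hg : g ≠ 0) : 0 < inner ℝ g (P.preimage g) := by
  have h := hP.lower (P.preimage g)
  have h1 := hP.form_preimage hκ g
  rw [h1] at h
  refine lt_of_lt_of_le ?_ h
  have h2 : P.preimage g ≠ 0 := fun h0 => hg (by rw [← h1, h0, map_zero])
  have := norm_pos_iff.2 h2
  positivity

theorem cut_form_apply (m : ℕ) (P : Ellipsoid d) (g x : EuclideanSpace ℝ (Fin d)) :
    (P.cut m g).form x =
      P.form x + (2 / (m * inner ℝ g (P.preimage g)) * inner ℝ g x) • g := by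
  simp [cut, mul_smul]

theorem Valid.cut (hP : P.Valid m V κ j) (hκ : 0 < κ) (hm : 0 < m)
    {g : EuclideanSpace ℝ (Fin d)} (hg : g ≠ 0) (hgV : g ∈ V) :
    (P.cut m g).Valid m V κ (j + 1) := by
  have hq := hP.inner_preimage_pos hκ hg
  have hu := hP.form_preimage hκ g
  have hm' : (0 : ℝ) < m := by exact_mod_cast hm
  refine ⟨fun x y => ?_, fun x => ?_, fun x => ?_, ?_, ?_⟩
  · rw [cut_form_apply, cut_form_apply, inner_add_left, inner_add_right, hP.symm x y,
      real_inner_smul_left, real_inner_smul_right, real_inner_comm g x]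
    ring
  · rw [cut_form_apply, inner_add_left, real_inner_smul_left]
    have h1 : 0 ≤ 2 / (m * inner ℝ g (P.preimage g)) * inner ℝ g x * inner ℝ g x := by
      rw [mul_assoc]; exact mul_nonneg (by positivity) (mul_self_nonneg _)
    linarith [hP.lower x]
  · rw [cut_form_apply, add_sub_right_comm]
    exact V.add_mem (hP.range x) (V.smul_mem _ hgV)
  -- With `u` the preimage of `g`, the new form is the old one after `x ↦ x + (2/(m⟪g, u⟫)) ⟪g, x⟫
  -- u`, whose determinant is `1 + 2/m`.
  · have h1 : (P.cut m g).form = P.form.comp (LinearMap.transvection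
        ((2 / (m * inner ℝ g (P.preimage g))) • (innerₛₗ ℝ g)) (P.preimage g)) := by
      ext1 x
      rw [cut_form_apply, LinearMap.comp_apply, LinearMap.transvection.apply, map_add, map_smul, hu]
      simp
    rw [h1, LinearMap.det_comp, LinearMap.transvection.det, hP.det, pow_succ]
    simp only [LinearMap.smul_apply, innerₛₗ_apply_apply, smul_eq_mul]
    field_simp
  · change (m + 1 : ℝ) ^ 2 / (m * (m + 2)) * P.size = _
    rw [hP.size]
    exact (pow_succ' _ j).symm

theorem Valid.contains_cut (hP : P.Valid m V κ j) (hκ : 0 < κ) (hm : 0 < m)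
    {g z : EuclideanSpace ℝ (Fin d)} (hg : g ≠ 0) (hz : P.Contains z)
    (hgz : inner ℝ g (z - P.centre) ≤ 0) : (P.cut m g).Contains z := by
  have hq := hP.inner_preimage_pos hκ hg
  have hu := hP.form_preimage hκ g
  have hm' : (0 : ℝ) < m := by exact_mod_cast hm
  have hs : 0 ≤ P.size := by rw [hP.size]; positivity
  unfold Contains at hz ⊢
  rw [cut_form_apply]
  have hsq := Real.sq_sqrt (div_nonneg hs hq.le)
  have hα0 := Real.sqrt_nonneg (P.size / inner ℝ g (P.preimage g))
  have hc : z - (P.cut m g).centre = (z - P.centre) +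
      (Real.sqrt (P.size / inner ℝ g (P.preimage g)) / (m + 2)) • P.preimage g := by
    simp only [Ellipsoid.cut]; abel
  have hsz : (P.cut m g).size = (m + 1) ^ 2 / (m * (m + 2)) * P.size := rfl
  rw [hc, hsz]
  generalize z - P.centre = w at *
  generalize P.preimage g = u at *
  set q := inner ℝ g u with hqdef
  generalize Real.sqrt (P.size / q) = α at *
  have hsize : P.size = α ^ 2 * q := by rw [hsq]; field_simp
  rw [hsize] at hz ⊢
  set t := inner ℝ g w with htdef
  have huw : inner ℝ (P.form w) u = t := by rw [hP.symm w u, hu, real_inner_comm]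
  -- Cauchy–Schwarz for the form, obtained by testing positivity on `w - (t/q) u`.
  have ht2 : t ^ 2 ≤ (α * q) ^ 2 := by
    have h1 := hP.lower (w - (t / q) • u)
    rw [map_sub, map_smul, hu, inner_sub_left, inner_sub_right, inner_sub_right,
      real_inner_smul_left, real_inner_smul_left, real_inner_smul_right, real_inner_smul_right,
      huw, ← hqdef, ← htdef] at h1
    have h2 : 0 ≤ κ * ‖w - (t / q) • u‖ ^ 2 := by positivity
    have h3 : t / q * (t / q * q) = t / q * t := by field_simp
    have h4 : t / q * t ≤ α ^ 2 * q := by linarith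
    rw [div_mul_eq_mul_div, div_le_iff₀ hq] at h4
    linarith
  have ht : -(α * q) ≤ t := (abs_le_of_sq_le_sq' ht2 (by positivity)).1
  have hexp : inner ℝ (P.form (w + (α / (m + 2)) • u) +
      (2 / (m * q) * inner ℝ g (w + (α / (m + 2)) • u)) • g) (w + (α / (m + 2)) • u) =
      inner ℝ (P.form w) w + 2 * (α / (m + 2)) * t + (α / (m + 2)) ^ 2 * q +
        2 / (m * q) * (t + α / (m + 2) * q) ^ 2 := by
    rw [map_add, map_smul, hu]
    simp only [inner_add_left, inner_add_right, real_inner_smul_left, real_inner_smul_right,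
      ← hqdef, ← htdef, huw]
    ring
  rw [hexp]
  -- The slack factors exactly and is nonnegative for `-αq ≤ t ≤ 0`. The constants are the classical
  -- ones for dimension `m + 1`, which avoids the degenerate dimension one.
  have hkey : (m + 1 : ℝ) ^ 2 / (m * (m + 2)) * (α ^ 2 * q) -
      (α ^ 2 * q + 2 * (α / (m + 2)) * t + (α / (m + 2)) ^ 2 * q +
        2 / (m * q) * (t + α / (m + 2) * q) ^ 2) = 2 / (m * q) * (-t * (t + α * q)) := by
    field_simp
    ring
  have h5 : 0 ≤ 2 / (m * q) * (-t * (t + α * q)) := by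
    have : 0 ≤ -t * (t + α * q) := mul_nonneg (by linarith) (by linarith)
    positivity
  linarith

/-- The largest form value on the unit sphere, in terms of a ball inside the ellipsoid. -/
theorem form_le_of_contains_ball {z : EuclideanSpace ℝ (Fin d)} {r : ℝ} (hr : 0 < r)
    (hP : P.Valid m V κ j) (hκ : 0 < κ)
    (hball : ∀ z', ‖z' - z‖ ≤ r → P.Contains z')
    {v : EuclideanSpace ℝ (Fin d)} (hv : ‖v‖ = 1) :
    inner ℝ (P.form v) v ≤ P.size / r ^ 2 := by
  have hn : ‖r • v‖ = r := by rw [norm_smul, hv, mul_one, Real.norm_of_nonneg hr.le]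
  have h1 := hball (z + r • v) (by rw [add_sub_cancel_left, hn])
  have h2 := hball (z - r • v) (by rw [sub_sub_cancel_left, norm_neg, hn])
  unfold Contains at h1 h2
  rw [add_sub_right_comm] at h1
  rw [sub_right_comm] at h2
  have h3 : 0 ≤ inner ℝ (P.form (z - P.centre)) (z - P.centre) :=
    le_trans (by positivity) (hP.lower _)
  generalize z - P.centre = y at *
  rw [map_add, map_smul] at h1
  rw [map_sub, map_smul] at h2
  simp only [inner_add_left, inner_add_right, inner_sub_left, inner_sub_right,
    real_inner_smul_left, real_inner_smul_right] at h1 h2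
  -- Adding the bounds at the two opposite points `y ± r v` cancels the cross terms.
  rw [le_div_iff₀ (by positivity)]
  linarith

/-- The volume bound of the ellipsoid method. -/
theorem Valid.pow_le (hP : P.Valid m V κ j) (hκ : 0 < κ) (hV : Module.finrank ℝ V ≤ m)
    {z : EuclideanSpace ℝ (Fin d)} {r : ℝ} (hr : 0 < r)
    (hball : ∀ z', ‖z' - z‖ ≤ r → P.Contains z') (hrκ : 1 ≤ P.size / (κ * r ^ 2)) :
    ((m + 2 : ℝ) / m) ^ j ≤ (P.size / (κ * r ^ 2)) ^ m := by
  classical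
  have hn : Module.finrank ℝ (EuclideanSpace ℝ (Fin d)) = d := finrank_euclideanSpace_fin
  set e := hP.symm.eigenvalues hn
  set v := hP.symm.eigenvectorBasis hn
  have hev : ∀ i, P.form (v i) = e i • v i := hP.symm.apply_eigenvectorBasis hn
  have hinner : ∀ i, inner ℝ (P.form (v i)) (v i) = e i := by
    intro i
    rw [hev, real_inner_smul_left, real_inner_self_eq_norm_sq, v.norm_eq_one]; simp
  have hlow : ∀ i, κ ≤ e i := by
    intro i
    have h := hP.lower (v i)
    rwa [hinner, v.norm_eq_one, one_pow, mul_one] at h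
  have hup : ∀ i, e i / κ ≤ if e i ≠ κ then P.size / (κ * r ^ 2) else 1 := by
    intro i
    split_ifs with h
    · have h1 := form_le_of_contains_ball hr hP hκ hball (v.norm_eq_one i)
      rw [hinner] at h1
      rw [div_le_iff₀ hκ]
      refine h1.trans (le_of_eq ?_)
      field_simp
    · rw [not_not] at h
      rw [h, div_self hκ.ne']
  -- An eigenvector with eigenvalue `e ≠ κ` satisfies `(e - κ) v ∈ V`, hence lies in `V`. This is
  -- where the ambient dimension drops out.
  have hcard : (Finset.univ.filter fun i => e i ≠ κ).card ≤ m := by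
    have hmem : ∀ i : {i // e i ≠ κ}, v i ∈ V := by
      rintro ⟨i, hi⟩
      have h := hP.range (v i)
      rw [hev, ← sub_smul] at h
      exact (V.smul_mem_iff (sub_ne_zero.2 hi)).1 h
    have hli : LinearIndependent ℝ fun i : {i // e i ≠ κ} => (⟨v i, hmem i⟩ : V) := by
      refine LinearIndependent.of_comp V.subtype ?_
      exact v.orthonormal.linearIndependent.comp _ Subtype.val_injective
    have h := hli.fintype_card_le_finrank
    rw [Fintype.card_subtype] at h
    exact h.trans hV
  have hdet : ∏ i, e i / κ = ((m + 2 : ℝ) / m) ^ j := by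
    have h := hP.symm.det_eq_prod_eigenvalues hn
    rw [hP.det] at h
    rw [Finset.prod_div_distrib, Finset.prod_const, Finset.card_univ, Fintype.card_fin,
      div_eq_iff (by positivity), mul_comm]
    simpa using h.symm
  calc ((m + 2 : ℝ) / m) ^ j = ∏ i, e i / κ := hdet.symm
    _ ≤ ∏ i, if e i ≠ κ then P.size / (κ * r ^ 2) else 1 :=
      Finset.prod_le_prod (fun i _ => div_nonneg (hκ.le.trans (hlow i)) hκ.le) fun i _ => hup i
    _ = (P.size / (κ * r ^ 2)) ^ (Finset.univ.filter fun i => e i ≠ κ).card := by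
      rw [Finset.prod_ite, Finset.prod_const, Finset.prod_const_one, mul_one]
    _ ≤ (P.size / (κ * r ^ 2)) ^ m := pow_le_pow_right₀ hrκ hcard

/-- The number of cuts of the ellipsoid method while a ball of radius `r` survives. -/
theorem Valid.count_le {R₁ : ℝ} (hP : P.Valid m V (R₁ ^ 2)⁻¹ j) (hm : 0 < m)
    (hV : Module.finrank ℝ V ≤ m) {z : EuclideanSpace ℝ (Fin d)} {r : ℝ} (hr : 0 < r)
    (hrR : r ≤ R₁) (hball : ∀ z', ‖z' - z‖ ≤ r → P.Contains z') :
    (j : ℝ) ≤ 6 * m ^ 2 * Real.log (R₁ / r) := by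
  have hm' : (1 : ℝ) ≤ m := by exact_mod_cast hm
  have hR : 0 < R₁ := hr.trans_le hrR
  have hρ : 1 ≤ (m + 1 : ℝ) ^ 2 / (m * (m + 2)) := by
    rw [one_le_div (by positivity)]; linarith
  have hrat : 1 ≤ R₁ / r := (one_le_div hr).2 hrR
  have hsz : P.size / ((R₁ ^ 2)⁻¹ * r ^ 2) =
      ((m + 1 : ℝ) ^ 2 / (m * (m + 2))) ^ j * (R₁ / r) ^ 2 := by
    rw [hP.size]; field_simp
  have h := hP.pow_le (by positivity) hV hr hball (by
    rw [hsz]; exact one_le_mul_of_one_le_of_one_le (one_le_pow₀ hρ) (one_le_pow₀ hrat))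
  rw [hsz] at h
  have hlog := Real.log_le_log (by positivity) h
  rw [Real.log_pow, Real.log_pow, Real.log_mul (by positivity) (by positivity), Real.log_pow,
    Real.log_pow] at hlog
  -- On the logarithmic scale each cut raises the determinant by at least `2/(m+2)`, while the
  -- growth of the size costs at most `1/(m+2)` over `m` directions. The net gain is `1/(m+2)` per
  -- cut.
  have hβ : 2 / (m + 2 : ℝ) ≤ Real.log ((m + 2 : ℝ) / m) := by
    have h1 := Real.log_le_sub_one_of_pos (by positivity : 0 < (m : ℝ) / (m + 2))
    rw [← inv_div (m : ℝ), Real.log_inv]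
    have h2 : 2 / (m + 2 : ℝ) = 1 - (m : ℝ) / (m + 2) := by field_simp; ring
    linarith
  have hρl : m * Real.log ((m + 1 : ℝ) ^ 2 / (m * (m + 2))) ≤ 1 / (m + 2) := by
    have h1 := Real.log_le_sub_one_of_pos
      (by positivity : 0 < (m + 1 : ℝ) ^ 2 / (m * (m + 2)))
    have h2 := mul_le_mul_of_nonneg_left h1 (by positivity : (0 : ℝ) ≤ m)
    refine h2.trans (le_of_eq ?_)
    field_simp
    ring
  have hj : (0 : ℝ) ≤ j := j.cast_nonneg
  have hΛ := Real.log_nonneg hrat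
  have h1 : (j : ℝ) * (1 / (m + 2)) ≤ 2 * m * Real.log (R₁ / r) := by
    have h2 := mul_le_mul_of_nonneg_left hβ hj
    have h3 := mul_le_mul_of_nonneg_left hρl hj
    have h4 : (2 : ℝ) / (m + 2) = 1 / (m + 2) + 1 / (m + 2) := by ring
    rw [h4] at h2
    push_cast at hlog
    linarith
  rw [mul_one_div, div_le_iff₀ (by positivity)] at h1
  refine h1.trans ?_
  have h2 : 2 * (m : ℝ) * (m + 2) ≤ 6 * m ^ 2 := by nlinarith
  nlinarith

end Ellipsoid

end Ellipsoid

/-! ### The cutting plane method with an unknown gradient space -/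

section CuttingPlane

variable {d : ℕ}

/-- A point that minimizes `‖x‖₄⁴` among the points with the same projection to `S` as `p`. -/
noncomputable def fiberMin (S : Submodule ℝ (EuclideanSpace ℝ (Fin d)))
    (p : EuclideanSpace ℝ (Fin d)) : EuclideanSpace ℝ (Fin d) :=
  Classical.epsilon fun x => x - p ∈ Sᗮ ∧ cube x ∈ S ∧ l4pow x ≤ l4pow p

theorem fiberMin_spec (S : Submodule ℝ (EuclideanSpace ℝ (Fin d)))
    (p : EuclideanSpace ℝ (Fin d)) :
    fiberMin S p - p ∈ Sᗮ ∧ cube (fiberMin S p) ∈ S ∧ l4pow (fiberMin S p) ≤ l4pow p :=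
  Classical.epsilon_spec (exists_l4pow_min_on_fiber S p)

/-- The memory of the cutting plane method. -/
structure CutState (d : ℕ) where
  /-- the localizing ellipsoid -/
  ell : Ellipsoid d
  /-- the span of the loss gradients seen so far -/
  seen : Submodule ℝ (EuclideanSpace ℝ (Fin d))
  /-- the useful queries together with their answers -/
  hist : List (EuclideanSpace ℝ (Fin d) × EuclideanSpace ℝ (Fin d))

namespace CutState

/-- The projection of the centre to the span of the loss gradients seen so far. -/
noncomputable def shadow (s : CutState d) : EuclideanSpace ℝ (Fin d) :=
  s.seen.starProjection s.ell.centre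

/-- The point at which the gradient is queried. -/
noncomputable def probe (s : CutState d) : EuclideanSpace ℝ (Fin d) :=
  fiberMin s.seen s.shadow

open Classical in
/-- The state after a step, where `v` is the gradient of the objective at the probe. -/
noncomputable def next (lam : ℝ) (m : ℕ) (R₁ : ℝ) (s : CutState d)
    (v : EuclideanSpace ℝ (Fin d)) : CutState d :=
  if ‖s.shadow‖ ≤ R₁ then
    if v - (4 * lam) • cube s.probe ∈ s.seen then
      ⟨s.ell.cut m v, s.seen, (s.probe, v) :: s.hist⟩
    else
      ⟨s.ell, s.seen ⊔ Submodule.span ℝ {v - (4 * lam) • cube s.probe}, (s.probe, v) :: s.hist⟩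
  else ⟨s.ell.cut m s.shadow, s.seen, s.hist⟩

/-- One step of the cutting plane method for an objective with gradient `G`. -/
noncomputable def micro (lam : ℝ) (m : ℕ) (R₁ : ℝ)
    (G : EuclideanSpace ℝ (Fin d) → EuclideanSpace ℝ (Fin d)) (s : CutState d) : CutState d :=
  s.next lam m R₁ (G s.probe)

/-- The initial state, whose ellipsoid is the ball of radius `R₁`. -/
noncomputable def start (d : ℕ) (R₁ : ℝ) : CutState d := ⟨.ball d (R₁ ^ 2)⁻¹, ⊥, []⟩

end CutState

/-- The ellipsoid method for `λ‖x‖₄⁴ + h(x)` where the gradients of `h` span a space of dimension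
at most `m`. It localizes the minimizer in the ball of radius `R`, starting with the ball of
radius `R₁`, and proposes a point certified to be `c`-optimal. -/
noncomputable def cutMachine (d m : ℕ) (lam R R₁ c : ℝ) : GradMachine d where
  Mem := CutState d
  start := .start d R₁
  query := CutState.probe
  update := CutState.next lam m R₁
  output s := Classical.epsilon (IsCertified R c s.hist)

namespace CutState

/-- The invariant of the cutting plane method after `t` steps. -/
structure Invariant (F' : EuclideanSpace ℝ (Fin d) → EuclideanSpace ℝ (Fin d)) (m : ℕ)
    (V : Submodule ℝ (EuclideanSpace ℝ (Fin d))) (R R₁ r c : ℝ) (t : ℕ) (s : CutState d) :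
    Prop where
  seen_le : s.seen ≤ V
  hist_eq : ∀ e ∈ s.hist, e.2 = F' e.1
  localized : ∀ z, ‖z‖ ≤ R → (∀ e ∈ s.hist, c ≤ inner ℝ e.2 (e.1 - z)) →
    ∃ j, t ≤ j + Module.finrank ℝ s.seen ∧ s.ell.Valid m V (R₁ ^ 2)⁻¹ j ∧
      ∀ z', ‖z' - z‖ ≤ r → s.ell.Contains z'

variable {F' g : EuclideanSpace ℝ (Fin d) → EuclideanSpace ℝ (Fin d)} {m : ℕ}
  {V : Submodule ℝ (EuclideanSpace ℝ (Fin d))} {lam R R₁ r c Γ : ℝ}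

theorem invariant_start (hR₁ : 0 < R₁) (hR : R + r ≤ R₁) :
    Invariant F' m V R R₁ r c 0 (start d R₁) where
  seen_le := bot_le
  hist_eq := by simp [start]
  localized z hz _ := by
    refine ⟨0, Nat.zero_le _, Ellipsoid.valid_ball _ _ _, fun z' hz' => ?_⟩
    refine Ellipsoid.contains_ball ?_
    have h1 : ‖z'‖ ≤ R₁ := by
      calc ‖z'‖ = ‖z + (z' - z)‖ := by rw [add_sub_cancel]
        _ ≤ ‖z‖ + ‖z' - z‖ := norm_add_le _ _
        _ ≤ R₁ := by linarith
    rw [inv_mul_le_iff₀ (by positivity), mul_one]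
    gcongr

/-- Every step is charged either to a cut or to a new dimension of `seen`. While some `z` beats all
recorded queries by `c`, a whole `r`-ball around it survives, since by `hΓ` moving by `r` changes a
cut value by at most `c`. -/
theorem invariant_micro (hlam : 0 < lam) (hm : 0 < m) (hR₁ : 0 < R₁) (hR : R + r ≤ R₁)
    (hc : 0 < c) (hF' : ∀ x, F' x = (4 * lam) • cube x + g x) (hgV : ∀ x, g x ∈ V)
    (hg : ∀ x, ‖g x‖ ≤ Γ) (hΓ : (4 * lam * R₁ ^ 3 + Γ) * r ≤ c) {t : ℕ} {s : CutState d}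
    (hs : Invariant F' m V R R₁ r c t s) :
    Invariant F' m V R R₁ r c (t + 1) (s.micro lam m R₁ F') := by
  have hκ : 0 < (R₁ ^ 2)⁻¹ := by positivity
  have hpS : s.shadow ∈ s.seen := Submodule.starProjection_apply_mem _ _
  have hpc : s.ell.centre - s.shadow ∈ s.seenᗮ := Submodule.sub_starProjection_mem_orthogonal _
  obtain ⟨hx1, hx2, hx3⟩ := fiberMin_spec s.seen s.shadow
  change s.probe - s.shadow ∈ s.seenᗮ at hx1
  change cube s.probe ∈ s.seen at hx2
  change l4pow s.probe ≤ _ at hx3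
  have hgx : F' s.probe - (4 * lam) • cube s.probe = g s.probe := by rw [hF']; abel
  unfold micro next
  rw [hgx]
  split_ifs with h1 h2
  · have hvS : F' s.probe ∈ s.seen := by
      rw [hF']; exact s.seen.add_mem (s.seen.smul_mem _ hx2) h2
    have hvn : ‖F' s.probe‖ ≤ 4 * lam * R₁ ^ 3 + Γ := by
      rw [hF']
      refine (norm_add_le _ _).trans (add_le_add ?_ (hg _))
      rw [norm_smul, Real.norm_of_nonneg (by positivity)]
      refine mul_le_mul_of_nonneg_left (norm_cube_le hR₁.le (hx3.trans ?_)) (by positivity)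
      exact (l4pow_le_norm_pow_four _).trans (by gcongr)
    refine ⟨hs.seen_le, ?_, fun z hz hcut => ?_⟩
    · intro e he
      rcases List.mem_cons.1 he with rfl | he
      exacts [rfl, hs.hist_eq e he]
    · obtain ⟨j, hj, hval, hcon⟩ := hs.localized z hz fun e he => hcut e (List.mem_cons_of_mem _ he)
      have hz0 : c ≤ inner ℝ (F' s.probe) (s.probe - z) := hcut _ List.mem_cons_self
      have hv0 : F' s.probe ≠ 0 := by
        intro h0; rw [h0, inner_zero_left] at hz0; linarith
      refine ⟨j + 1, by change t + 1 ≤ j + 1 + Module.finrank ℝ s.seen; omega,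
        hval.cut hκ hm hv0 (hs.seen_le hvS), fun z' hz' => ?_⟩
      refine hval.contains_cut hκ hm hv0 (hcon z' hz') ?_
      -- The probe and the centre differ by a vector orthogonal to `seen`, which contains the
      -- gradient; so the cut through the probe is a central cut.
      have h3 : inner ℝ (F' s.probe) (s.probe - s.ell.centre) = 0 := by
        refine (Submodule.mem_orthogonal _ _).1 ?_ _ hvS
        rw [← sub_sub_sub_cancel_right _ _ s.shadow]
        exact s.seenᗮ.sub_mem hx1 hpc
      have h4 : z' - s.ell.centre = (z' - z) - (s.probe - z) + (s.probe - s.ell.centre) := by abel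
      rw [h4, inner_add_right, inner_sub_right, h3]
      have h5 : inner ℝ (F' s.probe) (z' - z) ≤ (4 * lam * R₁ ^ 3 + Γ) * r :=
        (real_inner_le_norm _ _).trans
          (mul_le_mul hvn hz' (norm_nonneg _) ((norm_nonneg _).trans hvn))
      linarith
  · refine ⟨sup_le hs.seen_le ?_, ?_, fun z hz hcut => ?_⟩
    · rw [Submodule.span_singleton_le_iff_mem]
      exact hgV _
    · intro e he
      rcases List.mem_cons.1 he with rfl | he
      exacts [rfl, hs.hist_eq e he]
    · obtain ⟨j, hj, hval, hcon⟩ := hs.localized z hz fun e he => hcut e (List.mem_cons_of_mem _ he)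
      have h3 : s.seen < s.seen ⊔ Submodule.span ℝ {g s.probe} := by
        rw [left_lt_sup, Submodule.span_singleton_le_iff_mem]
        exact h2
      have h4 := Submodule.finrank_lt_finrank_of_lt h3
      exact ⟨j, by dsimp only; omega, hval, hcon⟩
  -- A shadow outside the `R₁`-ball is itself a cut direction, and costs no history entry. In the
  -- other cases `‖shadow‖ ≤ R₁`, which bounds the quartic gradient at the probe.
  · refine ⟨hs.seen_le, hs.hist_eq, fun z hz hcut => ?_⟩
    obtain ⟨j, hj, hval, hcon⟩ := hs.localized z hz hcut
    have hp0 : s.shadow ≠ 0 := by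
      intro h0; rw [h0, norm_zero] at h1; exact h1 hR₁.le
    refine ⟨j + 1, by change t + 1 ≤ j + 1 + Module.finrank ℝ s.seen; omega,
      hval.cut hκ hm hp0 (hs.seen_le hpS), fun z' hz' => ?_⟩
    refine hval.contains_cut hκ hm hp0 (hcon z' hz') ?_
    have h3 : inner ℝ s.shadow (s.ell.centre - s.shadow) = 0 :=
      (Submodule.mem_orthogonal _ _).1 hpc _ hpS
    have h4 : z' - s.ell.centre = z' - s.shadow - (s.ell.centre - s.shadow) := by abel
    rw [h4, inner_sub_right, h3, inner_sub_right, real_inner_self_eq_norm_sq]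
    have h5 : ‖z'‖ ≤ R₁ := by
      calc ‖z'‖ = ‖z + (z' - z)‖ := by rw [add_sub_cancel]
        _ ≤ ‖z‖ + ‖z' - z‖ := norm_add_le _ _
        _ ≤ R₁ := by linarith
    have h6 := real_inner_le_norm s.shadow z'
    have h7 := norm_nonneg s.shadow
    nlinarith

end CutState

/-- If no certificate existed, some `z` in the `R`-ball would survive all cuts; then the number of
cuts plus the dimension of `seen` would be too small for `t` steps. -/
theorem cutMachine_gap {F : EuclideanSpace ℝ (Fin d) → ℝ}
    {g : EuclideanSpace ℝ (Fin d) → EuclideanSpace ℝ (Fin d)} {m : ℕ}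
    {V : Submodule ℝ (EuclideanSpace ℝ (Fin d))} {lam R R₁ r c Γ : ℝ}
    (hF : ∀ x y, F x + inner ℝ (gradient F x) (y - x) ≤ F y)
    (hlam : 0 < lam) (hm : 0 < m) (hR0 : 0 ≤ R) (hR : R + r ≤ R₁)
    (hc : 0 < c) (hr : 0 < r) (hF' : ∀ x, gradient F x = (4 * lam) • cube x + g x)
    (hgV : ∀ x, g x ∈ V) (hV : Module.finrank ℝ V ≤ m)
    (hg : ∀ x, ‖g x‖ ≤ Γ) (hΓ : (4 * lam * R₁ ^ 3 + Γ) * r ≤ c) {t : ℕ}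
    (ht : m + 6 * m ^ 2 * Real.log (R₁ / r) < t) {z : EuclideanSpace ℝ (Fin d)} (hz : ‖z‖ ≤ R) :
    F ((cutMachine d m lam R R₁ c).output (((cutMachine d m lam R R₁ c).micro (gradient F))^[t]
      (cutMachine d m lam R R₁ c).start)) ≤ F z + c := by
  have hR₁ : 0 < R₁ := by linarith
  have hinv : ∀ t : ℕ, CutState.Invariant (gradient F) m V R R₁ r c t
      ((CutState.micro lam m R₁ (gradient F))^[t] (.start d R₁)) := by
    intro t
    induction t with
    | zero => exact CutState.invariant_start hR₁ hR
    | succ t ih =>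
      rw [Function.iterate_succ_apply']
      exact CutState.invariant_micro hlam hm hR₁ hR hc hF' hgV hg hΓ ih
  change F (Classical.epsilon (IsCertified R c
    ((CutState.micro lam m R₁ (gradient F))^[t] (.start d R₁)).hist)) ≤ _
  have hs := hinv t
  generalize (CutState.micro lam m R₁ (gradient F))^[t] (.start d R₁) = s at hs
  have hex : ∃ xh, IsCertified R c s.hist xh := by
    refine exists_isCertified hR0 ?_
    by_contra! hcon
    obtain ⟨z, hz, hcut⟩ := hcon
    obtain ⟨j, hj, hval, hball⟩ := hs.localized z hz hcut
    have h1 := hval.count_le hm hV hr (by linarith) hball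
    have h2 : Module.finrank ℝ s.seen ≤ m := (Submodule.finrank_mono hs.seen_le).trans hV
    have h3 : (t : ℝ) ≤ j + m := by exact_mod_cast hj.trans (Nat.add_le_add_left h2 j)
    linarith
  exact (Classical.epsilon_spec hex).le hF hs.hist_eq hz

end CuttingPlane

/-! ### The objective and its smoothing -/

section Objective

variable {d m : ℕ} {mu lam : ℝ} {a : Fin m → EuclideanSpace ℝ (Fin d)} {b : Fin m → ℝ}

theorem smoothObj_eq (mu lam : ℝ) (a : Fin m → EuclideanSpace ℝ (Fin d)) (b : Fin m → ℝ)
    (x : EuclideanSpace ℝ (Fin d)) :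
    smoothObj mu lam a b x = lam * l4pow x + hingeAvg mu a b x := rfl

theorem gradient_smoothObj (hmu : 0 < mu) (x : EuclideanSpace ℝ (Fin d)) :
    gradient (smoothObj mu lam a b) x = (4 * lam) • cube x + hingeGrad mu a b x := by
  refine HasGradientAt.gradient ?_
  have h1 := (hasGradientAt_l4pow x).hasFDerivAt.const_mul lam
  have h2 := (hasGradientAt_hingeAvg a b hmu x).hasFDerivAt
  rw [hasGradientAt_iff_hasFDerivAt]
  refine (h1.add h2).congr_fderiv ?_
  ext v
  simp
  ring

theorem smoothObj_tangent (hmu : 0 < mu) (hlam : 0 < lam) (x y : EuclideanSpace ℝ (Fin d)) :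
    smoothObj mu lam a b x + inner ℝ (gradient (smoothObj mu lam a b) x) (y - x) ≤
      smoothObj mu lam a b y := by
  rw [gradient_smoothObj hmu, smoothObj_eq, smoothObj_eq, inner_add_left, real_inner_smul_left]
  have h1 := mul_le_mul_of_nonneg_left (l4pow_tangent' x y) hlam.le
  linarith [hingeAvg_tangent a b hmu x y]

theorem svmObj_le_smoothObj (hmu : 0 < mu) (x : EuclideanSpace ℝ (Fin d)) :
    svmObj lam a b x ≤ smoothObj mu lam a b x := by
  unfold svmObj smoothObj
  gcongr
  exact max_le_shinge hmu _

theorem smoothObj_le_svmObj_add (hmu : 0 < mu) (hm : 0 < m) (x : EuclideanSpace ℝ (Fin d)) :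
    smoothObj mu lam a b x ≤ svmObj lam a b x + mu := by
  have hm' : (0 : ℝ) < m := by exact_mod_cast hm
  have h1 : (1 / (m : ℝ)) * ∑ i, shinge mu (1 - b i * inner ℝ (a i) x) ≤
      (1 / (m : ℝ)) * ∑ i, (max 0 (1 - b i * inner ℝ (a i) x) + mu) := by
    gcongr
    exact shinge_le hmu _
  rw [Finset.sum_add_distrib, mul_add, Finset.sum_const, Finset.card_univ, Fintype.card_fin,
    nsmul_eq_mul, ← mul_assoc, one_div_mul_cancel hm'.ne', one_mul] at h1
  unfold svmObj smoothObj
  linarith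

theorem svmObj_zero_le (hm : 0 < m) : svmObj lam a b 0 ≤ 1 := by
  have hm' : (0 : ℝ) < m := by exact_mod_cast hm
  simp [svmObj, l4pow]
  field_simp
  rfl

theorem hinge_nonneg (x : EuclideanSpace ℝ (Fin d)) :
    0 ≤ (1 / (m : ℝ)) * ∑ i, max 0 (1 - b i * inner ℝ (a i) x) :=
  mul_nonneg (by positivity) (Finset.sum_nonneg fun _ _ => le_max_left _ _)

theorem svmObj_nonneg (hlam : 0 < lam) (x : EuclideanSpace ℝ (Fin d)) : 0 ≤ svmObj lam a b x :=
  add_nonneg (mul_nonneg hlam.le (l4pow_nonneg x)) (hinge_nonneg x)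

theorem exists_svmObj_min (hlam : 0 < lam) : ∃ u, ∀ x, svmObj lam a b u ≤ svmObj lam a b x :=
  exists_forall_quartic_add_le hlam
    (h := fun x => (1 / (m : ℝ)) * ∑ i, max 0 (1 - b i * inner ℝ (a i) x)) (by fun_prop)
    hinge_nonneg

theorem continuous_hingeAvg (hmu : 0 < mu) : Continuous (hingeAvg mu a b) :=
  continuous_iff_continuousAt.2 fun x => (hasGradientAt_hingeAvg a b hmu x).continuousAt

theorem exists_smoothObj_min (hmu : 0 < mu) (hlam : 0 < lam) :
    ∃ u, ∀ x, smoothObj mu lam a b u ≤ smoothObj mu lam a b x :=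
  exists_forall_quartic_add_le hlam (continuous_hingeAvg hmu) (hingeAvg_nonneg a b hmu)

theorem gradient_smoothObj_min {u : EuclideanSpace ℝ (Fin d)}
    (h : ∀ x, smoothObj mu lam a b u ≤ smoothObj mu lam a b x) :
    gradient (smoothObj mu lam a b) u = 0 := by
  have h1 : IsLocalMin (smoothObj mu lam a b) u := Filter.Eventually.of_forall h
  rw [gradient, h1.fderiv_eq_zero, map_zero]

/-- Comparison with the origin gives `λ‖u‖₄⁴ ≤ 1`, hence `‖u‖⁴ ≤ d/λ`. The bound is crude so as to
be rational in the parameters. -/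
theorem norm_svmObj_min_le (hlam : 0 < lam) (hm : 0 < m) {u : EuclideanSpace ℝ (Fin d)}
    (h : ∀ x, svmObj lam a b u ≤ svmObj lam a b x) : ‖u‖ ≤ 1 + 2 * d / lam := by
  have h1 : lam * l4pow u ≤ 1 := by
    have h2 := (h 0).trans (svmObj_zero_le hm)
    have h3 : svmObj lam a b u = lam * l4pow u +
      (1 / (m : ℝ)) * ∑ i, max 0 (1 - b i * inner ℝ (a i) u) := rfl
    linarith [hinge_nonneg (a := a) (b := b) u]
  have h2 : ‖u‖ ^ 4 ≤ d / lam := by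
    rw [le_div_iff₀ hlam]
    have h3 := mul_le_mul_of_nonneg_left (norm_pow_four_le u) hlam.le
    have h4 := mul_le_mul_of_nonneg_left h1 (Nat.cast_nonneg (α := ℝ) d)
    linarith
  have h3 : 0 ≤ (d : ℝ) / lam := by positivity
  rw [mul_div_assoc]
  by_contra! hlt
  have h4 : 1 ≤ ‖u‖ := by linarith
  have h5 : ‖u‖ ≤ ‖u‖ ^ 4 := le_self_pow₀ h4 (by norm_num)
  linarith

end Objective

/-! ### Iteration budget and calls per iteration -/

section Parameters

/-- The iteration count without its logarithmic factor. -/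
noncomputable def budget (d : ℕ) (lam gram eps : ℝ) : ℝ :=
  (d * (lam + gram ^ 2) / lam) ^ (1 / 5 : ℝ) / eps ^ (3 / 5 : ℝ)

/-- A polynomial in `d`, `m`, `λ`, `λ⁻¹` and the spectral norm. -/
noncomputable def sizeParam (d m : ℕ) (lam gram : ℝ) : ℝ :=
  (1 + d) * (1 + m) * (1 + lam) * (1 + lam⁻¹) * (1 + gram)

/-- The number of gradient calls in an iteration. -/
noncomputable def callCount (d m : ℕ) (lam gram eps : ℝ) : ℕ :=
  ⌈8 * logO (136 * sizeParam d m lam gram ^ 5 / eps)⌉₊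

/-- The polynomial in the bound on the number of calls. -/
noncomputable def sizePoly : MvPolynomial (Fin 6) ℕ :=
  136 * ((1 + .X 0) * (1 + .X 1) * (1 + .X 2) * (1 + .X 3) * (1 + .X 4)) ^ 5

variable {d m : ℕ} {lam gram eps : ℝ}

theorem aeval_sizePoly (t : ℝ) :
    MvPolynomial.aeval ![(d : ℝ), (m : ℝ), lam, lam⁻¹, gram, t] sizePoly =
      136 * sizeParam d m lam gram ^ 5 := by
  simp [sizePoly, sizeParam]

theorem one_le_logO (t : ℝ) : 1 ≤ logO t := le_max_left _ _

theorem log_le_logO (t : ℝ) : Real.log t ≤ logO t := le_max_right _ _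

theorem budget_pow_five (hlam : 0 < lam) (heps : 0 < eps) :
    budget d lam gram eps ^ 5 = d * (lam + gram ^ 2) / lam / eps ^ 3 := by
  unfold budget
  rw [div_pow, ← Real.rpow_mul_natCast (by positivity), ← Real.rpow_mul_natCast heps.le]
  norm_num

/-- Needed to absorb the rounding in `⌈9B⌉ ≤ 10B`. -/
theorem one_le_budget (hd : 0 < d) (hlam : 0 < lam) (heps : 0 < eps) (heps1 : eps ≤ 1) :
    1 ≤ budget d lam gram eps := by
  have h0 : 0 ≤ budget d lam gram eps := by unfold budget; positivity
  by_contra! hlt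
  have h1 : budget d lam gram eps ^ 5 < 1 := pow_lt_one₀ h0 hlt (by norm_num)
  rw [budget_pow_five hlam heps, div_div, div_lt_one (by positivity)] at h1
  have hd' : (1 : ℝ) ≤ d := by exact_mod_cast hd
  have h2 : eps ^ 3 ≤ 1 := pow_le_one₀ heps.le heps1
  have h3 : lam * eps ^ 3 ≤ lam := by nlinarith
  have h4 : 0 ≤ gram ^ 2 := sq_nonneg _
  have h5 : lam + gram ^ 2 ≤ d * (lam + gram ^ 2) := le_mul_of_one_le_left (by positivity) hd'
  linarith

theorem one_le_sizeParam (hlam : 0 < lam) (hG : 0 ≤ gram) : 1 ≤ sizeParam d m lam gram := by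
  unfold sizeParam
  have hl := inv_pos.2 hlam
  refine one_le_mul_of_one_le_of_one_le (one_le_mul_of_one_le_of_one_le
    (one_le_mul_of_one_le_of_one_le (one_le_mul_of_one_le_of_one_le ?_ ?_) ?_) ?_) ?_ <;>
    simp [hlam.le, hG]

theorem sizeParam_bounds (hlam : 0 < lam) (hG : 0 ≤ gram) :
    d * lam ≤ sizeParam d m lam gram ∧ 1 + d / lam ≤ sizeParam d m lam gram ∧
      1 + gram ≤ sizeParam d m lam gram := by
  have hl := inv_pos.2 hlam
  have hd : (0 : ℝ) ≤ d := d.cast_nonneg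
  have hm : (0 : ℝ) ≤ m := m.cast_nonneg
  have h1 : (1 : ℝ) ≤ 1 + d := by linarith
  have h2 : (1 : ℝ) ≤ 1 + m := by linarith
  have h3 : 1 ≤ 1 + lam := by linarith
  have h4 : 1 ≤ 1 + lam⁻¹ := by linarith
  have h5 : 1 ≤ 1 + gram := by linarith
  refine ⟨?_, ?_, ?_⟩
  · calc d * lam ≤ ((1 + d) * 1 * (1 + lam) * 1 * 1 : ℝ) := by nlinarith
      _ ≤ sizeParam d m lam gram := by unfold sizeParam; gcongr
  · calc 1 + d / lam ≤ ((1 + d) * 1 * 1 * (1 + lam⁻¹) * 1 : ℝ) := by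
          rw [div_eq_mul_inv]; nlinarith
      _ ≤ sizeParam d m lam gram := by unfold sizeParam; gcongr
  · calc 1 + gram = (1 * 1 * 1 * 1 * (1 + gram) : ℝ) := by ring
      _ ≤ sizeParam d m lam gram := by unfold sizeParam; gcongr

theorem callCount_le : (callCount d m lam gram eps : ℝ) ≤
    10 * logO (136 * sizeParam d m lam gram ^ 5 / eps) := by
  have h := one_le_logO (136 * sizeParam d m lam gram ^ 5 / eps)
  have h1 := Nat.ceil_lt_add_one (by linarith :
    0 ≤ 8 * logO (136 * sizeParam d m lam gram ^ 5 / eps))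
  unfold callCount
  linarith

theorem le_callCount : 8 * logO (136 * sizeParam d m lam gram ^ 5 / eps) ≤
    (callCount d m lam gram eps : ℝ) := Nat.le_ceil _

/-- `K` halvings take an initial gap of at most `2` down to `ε/2`. -/
theorem half_pow_callCount_le (hlam : 0 < lam) (hG : 0 ≤ gram) (heps : 0 < eps) :
    2 * (1 / 2) ^ callCount d m lam gram eps ≤ eps / 2 := by
  have hW : 1 ≤ 136 * sizeParam d m lam gram ^ 5 := by
    linarith [one_le_pow₀ (n := 5) (one_le_sizeParam (d := d) (m := m) hlam hG)]
  have hK := le_callCount (d := d) (m := m) (lam := lam) (gram := gram) (eps := eps)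
  have hy := one_le_logO (136 * sizeParam d m lam gram ^ 5 / eps)
  have hlog := log_le_logO (136 * sizeParam d m lam gram ^ 5 / eps)
  generalize callCount d m lam gram eps = K at *
  generalize 136 * sizeParam d m lam gram ^ 5 = W at *
  have h1 : -Real.log eps ≤ logO (W / eps) := by
    rw [Real.log_div (by positivity) heps.ne'] at hlog
    linarith [Real.log_nonneg hW]
  have h2 : (2 : ℝ)⁻¹ ^ K = Real.exp (-(K * Real.log 2)) := by
    rw [Real.exp_neg, Real.exp_nat_mul, Real.exp_log two_pos, inv_pow]
  have h3 : Real.exp (-(K * Real.log 2)) ≤ Real.exp (Real.log eps - 4) := by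
    refine Real.exp_le_exp.2 ?_
    have h4 := Real.log_two_gt_d9
    nlinarith
  rw [Real.exp_sub, Real.exp_log heps] at h3
  have h5 : eps / Real.exp 4 ≤ eps / 4 := by
    gcongr
    linarith [Real.add_one_le_exp (4 : ℝ)]
  rw [one_div, h2]
  linarith

/-- The argument is the ratio `R₁/r` of the ellipsoid method. With `W = sizeParam`, its numerator is
at most `2 · 2W · 33W⁴ ≤ 136 W⁵`. -/
theorem log_ratio_le (hd : 0 < d) (hlam : 0 < lam) (hG : 0 ≤ gram) (heps : 0 < eps) :
    Real.log ((2 + 2 * d / lam) / (eps / 2 / (4 * lam * (2 + 2 * d / lam) ^ 3 + (1 + gram)))) ≤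
      logO (136 * sizeParam d m lam gram ^ 5 / eps) := by
  refine le_trans (Real.log_le_log (by positivity) ?_) (log_le_logO _)
  obtain ⟨h1, h2, h3⟩ := sizeParam_bounds (d := d) (m := m) hlam hG
  have hW := one_le_sizeParam (d := d) (m := m) hlam hG
  generalize sizeParam d m lam gram = W at *
  have hd' : (1 : ℝ) ≤ d := by exact_mod_cast hd
  have h4 : lam ≤ W := le_trans (le_mul_of_one_le_left hlam.le hd') h1
  have h5 : 2 + 2 * d / lam ≤ 2 * W := by rw [mul_div_assoc]; linarith
  have h6 : 4 * lam * (2 + 2 * d / lam) ^ 3 + (1 + gram) ≤ 33 * W ^ 4 := by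
    have h7 : 4 * lam * (2 + 2 * d / lam) ^ 3 ≤ 4 * W * (2 * W) ^ 3 := by gcongr
    have h8 : W ≤ W ^ 4 := le_self_pow₀ hW (by norm_num)
    linarith
  rw [div_div_eq_mul_div, div_div_eq_mul_div]
  refine div_le_div_of_nonneg_right ?_ heps.le
  calc (2 + 2 * d / lam) * (4 * lam * (2 + 2 * d / lam) ^ 3 + (1 + gram)) * 2
      ≤ 2 * W * (33 * W ^ 4) * 2 := by gcongr
    _ ≤ 136 * W ^ 5 := by nlinarith [pow_nonneg (zero_le_one.trans hW) 5]

end Parameters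

/-! ### The two regimes -/

section Methods

variable {d m : ℕ} {lam eps : ℝ} {a : Fin m → EuclideanSpace ℝ (Fin d)} {b : Fin m → ℝ}

/-- The machine that proposes the origin. -/
noncomputable def zeroMachine (d : ℕ) : GradMachine d where
  Mem := Unit
  start := ()
  query _ := 0
  update _ _ := ()
  output _ := 0

/-- The method for the support vector machine: the origin for a coarse accuracy, the ellipsoid
method for few data points, and the accelerated method for many data points. -/
noncomputable def svmMethod (d m : ℕ) (lam gram eps : ℝ) : IterMethod d :=
  open Classical in
  if 1 ≤ eps then (zeroMachine d).toMethod 0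
  else if (m : ℝ) ^ 2 ≤ budget d lam gram eps then
    (cutMachine d m lam (1 + 2 * d / lam) (2 + 2 * d / lam) (eps / 2)).toMethod
      (callCount d m lam gram eps)
  else (accelMachine d lam (8 * gram / (m * eps)) ⌈9 * budget d lam gram eps⌉₊).toMethod
    (callCount d m lam gram eps)

theorem svmMethod_iterCalls_le (gram : ℝ) (F : EuclideanSpace ℝ (Fin d) → ℝ)
    (x₀ : EuclideanSpace ℝ (Fin d)) (n : ℕ) :
    ((svmMethod d m lam gram eps).iterCalls F x₀ n : ℝ) ≤
      10 * logO (136 * sizeParam d m lam gram ^ 5 / eps) := by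
  unfold svmMethod
  split_ifs
  · rw [GradMachine.toMethod_iterCalls]
    linarith [one_le_logO (136 * sizeParam d m lam gram ^ 5 / eps)]
  all_goals
    rw [GradMachine.toMethod_iterCalls]
    exact callCount_le

theorem cutMachine_svm_gap (hd : 0 < d) (hm : 0 < m) (hlam : 0 < lam) (heps : 0 < eps)
    (heps1 : eps ≤ 1) {xs : EuclideanSpace ℝ (Fin d)}
    (hxs : ∀ x, svmObj lam a b xs ≤ svmObj lam a b x) (x₀ : EuclideanSpace ℝ (Fin d)) {n : ℕ}
    (hn : (m : ℝ) ^ 2 ≤ n) :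
    smoothObj (eps / 4) lam a b (((cutMachine d m lam (1 + 2 * d / lam) (2 + 2 * d / lam)
      (eps / 2)).toMethod (callCount d m lam (gramNorm a b) eps)).iter
        (smoothObj (eps / 4) lam a b) x₀ n) ≤ smoothObj (eps / 4) lam a b xs + eps / 2 := by
  have hmu : 0 < eps / 4 := by positivity
  have hG := gramNorm_nonneg a b
  have hm' : (1 : ℝ) ≤ m := by exact_mod_cast hm
  have hn0 : n ≠ 0 := by
    rintro rfl
    rw [Nat.cast_zero] at hn
    nlinarith
  have hΓ : 1 ≤ 4 * lam * (2 + 2 * d / lam) ^ 3 + (1 + gramNorm a b) := by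
    have : 0 ≤ 4 * lam * (2 + 2 * d / lam) ^ 3 := by positivity
    linarith
  rw [GradMachine.toMethod_iter _ _ _ _ hn0]
  refine cutMachine_gap (m := m) (V := Submodule.span ℝ (Set.range fun i => b i • a i))
    (g := hingeGrad (eps / 4) a b)
    (r := eps / 2 / (4 * lam * (2 + 2 * d / lam) ^ 3 + (1 + gramNorm a b)))
    (Γ := 1 + gramNorm a b) (smoothObj_tangent hmu hlam) hlam hm
    (by positivity) ?_ (by positivity) (by positivity) (gradient_smoothObj hmu)
    (hingeGrad_mem_span _ _ _) ?_ (fun x => norm_hingeGrad_le _ _ _ x hm) ?_ ?_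
    (norm_svmObj_min_le hlam hm hxs)
  · have h1 : eps / 2 / (4 * lam * (2 + 2 * d / lam) ^ 3 + (1 + gramNorm a b)) ≤ 1 := by
      rw [div_le_one (by linarith)]
      linarith
    linarith
  · exact (finrank_range_le_card (R := ℝ) fun i => b i • a i).trans_eq (Fintype.card_fin m)
  · rw [mul_div_cancel₀ _ (by linarith : 4 * lam * (2 + 2 * d / lam) ^ 3 + (1 + gramNorm a b) ≠ 0)]
  · have h1 := log_ratio_le (m := m) hd hlam hG heps
    have h2 := le_callCount (d := d) (m := m) (lam := lam) (gram := gramNorm a b) (eps := eps)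
    have h3 := one_le_logO (136 * sizeParam d m lam (gramNorm a b) ^ 5 / eps)
    push_cast
    generalize Real.log ((2 + 2 * d / lam) / (eps / 2 / (4 * lam * (2 + 2 * d / lam) ^ 3 +
      (1 + gramNorm a b)))) = Λ at *
    generalize (callCount d m lam (gramNorm a b) eps : ℝ) = K at *
    generalize logO (136 * sizeParam d m lam (gramNorm a b) ^ 5 / eps) = y at *
    -- The factor `8` in the call count pays for `6m²Λ` cuts and `m` extensions of the span, with
    -- strict slack.
    have h4 : 8 * y * (m : ℝ) ^ 2 ≤ K * n := mul_le_mul h2 hn (by positivity) (by linarith)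
    have h5 : 6 * (m : ℝ) ^ 2 * Λ ≤ 6 * m ^ 2 * y := by gcongr
    nlinarith

theorem accelMachine_svm_gap (hd : 0 < d) (hm : 0 < m) (hlam : 0 < lam) (heps : 0 < eps)
    (heps1 : eps ≤ 1) (hmB : budget d lam (gramNorm a b) eps < (m : ℝ) ^ 2)
    (x x₀ : EuclideanSpace ℝ (Fin d)) {n : ℕ}
    (hn : 10 * budget d lam (gramNorm a b) eps ≤ n) :
    smoothObj (eps / 4) lam a b (((accelMachine d lam (8 * gramNorm a b / (m * eps))
      ⌈9 * budget d lam (gramNorm a b) eps⌉₊).toMethod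
        (callCount d m lam (gramNorm a b) eps)).iter (smoothObj (eps / 4) lam a b) x₀ n) ≤
      smoothObj (eps / 4) lam a b x + eps / 2 := by
  have hmu : 0 < eps / 4 := by positivity
  have hG := gramNorm_nonneg a b
  have hm' : (0 : ℝ) < m := by exact_mod_cast hm
  have hB := one_le_budget (gram := gramNorm a b) hd hlam heps heps1
  have hB5 := budget_pow_five (d := d) (gram := gramNorm a b) hlam heps
  have hK := half_pow_callCount_le (d := d) (m := m) hlam hG heps
  set B := budget d lam (gramNorm a b) eps
  set K := callCount d m lam (gramNorm a b) eps
  set T := ⌈9 * B⌉₊ with hTdef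
  have hT9 : 9 * B ≤ T := Nat.le_ceil _
  have hT : 0 < T := Nat.ceil_pos.2 (by linarith)
  have hTn : T ≤ n := by
    have h1 := Nat.ceil_lt_add_one (by linarith : 0 ≤ 9 * B)
    exact_mod_cast (by linarith : (T : ℝ) ≤ n)
  obtain ⟨u, hu⟩ := exists_smoothObj_min (a := a) (b := b) hmu hlam
  have hgu := gradient_smoothObj_min hu
  rw [gradient_smoothObj hmu] at hgu
  have h0 : smoothObj (eps / 4) lam a b 0 - smoothObj (eps / 4) lam a b u ≤ 2 := by
    have h1 := smoothObj_le_svmObj_add (lam := lam) (a := a) (b := b) hmu hm 0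
    have h2 := svmObj_zero_le (lam := lam) (a := a) (b := b) hm
    have h3 := svmObj_le_smoothObj (lam := lam) (a := a) (b := b) hmu u
    have h4 := svmObj_nonneg (a := a) (b := b) hlam u
    linarith
  -- One factor of `B ^ 5` is traded for `m ^ 2`, leaving `B ^ 4`. The constant `9` works because
  -- `96 · 64 = 6144 ≤ 6561 = 9⁴`.
  have hTL : 96 * (8 * gramNorm a b / (m * eps)) ^ 2 * d ≤ lam * eps * (T : ℝ) ^ 4 := by
    have h1 : d * gramNorm a b ^ 2 ≤ lam * eps ^ 3 * (B ^ 4 * m ^ 2) := by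
      have h2 : d * (lam + gramNorm a b ^ 2) = lam * eps ^ 3 * B ^ 5 := by
        rw [hB5]; field_simp
      have h3 : B ^ 5 ≤ B ^ 4 * m ^ 2 := by rw [pow_succ]; gcongr
      calc d * gramNorm a b ^ 2 ≤ d * (lam + gramNorm a b ^ 2) := by gcongr; linarith
        _ = lam * eps ^ 3 * B ^ 5 := h2
        _ ≤ _ := by gcongr
    have h2 : 96 * (8 * gramNorm a b / (m * eps)) ^ 2 * d =
        6144 * (d * gramNorm a b ^ 2) / (m * eps) ^ 2 := by
      field_simp; ring
    rw [h2, div_le_iff₀ (by positivity)]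
    calc 6144 * (d * gramNorm a b ^ 2) ≤ 6561 * (lam * eps ^ 3 * (B ^ 4 * m ^ 2)) := by
          have : 0 ≤ lam * eps ^ 3 * (B ^ 4 * m ^ 2) := by positivity
          linarith
      _ = lam * eps * (9 * B) ^ 4 * (m * eps) ^ 2 := by ring
      _ ≤ lam * eps * (T : ℝ) ^ 4 * (m * eps) ^ 2 := by gcongr
  rw [GradMachine.toMethod_iter _ _ _ _ (by omega)]
  have hgap := accelMachine_gap (F := smoothObj (eps / 4) lam a b)
    (h := hingeAvg (eps / 4) a b) (g := hingeGrad (eps / 4) a b)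
    (L := 8 * gramNorm a b / (m * eps)) (fun _ => rfl) hlam (by positivity)
    (hingeAvg_tangent a b hmu) (fun x y => by
      refine (hingeAvg_upper a b hmu x y).trans (le_of_eq ?_)
      field_simp
      ring) hu hgu (gradient_smoothObj hmu) hT heps hTL h0 (K * n)
  -- Since `T ≤ n`, the `K n` gradient steps contain at least `K` complete phases.
  have hdiv : K ≤ K * n / T := by
    rw [Nat.le_div_iff_mul_le hT]
    exact Nat.mul_le_mul_left K hTn
  have hmax : max (2 * (1 / 2 : ℝ) ^ (K * n / T)) (eps / 2) ≤ eps / 2 := by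
    refine max_le ?_ le_rfl
    have := pow_le_pow_of_le_one (by norm_num : (0 : ℝ) ≤ 1 / 2) (by norm_num) hdiv
    linarith
  linarith [hu x]

end Methods

/-! ### Assembly -/

theorem mainTheorem3 :
    -- universal constants, a universal polynomial, and a method that depends on the function only
    -- through `d`, `m`, `λ`, `‖Q̃ᵀQ̃‖` and on the target accuracy `ε`
    ∃ (C : ℝ) (k : ℕ) (P : MvPolynomial (Fin 6) ℕ)
      (A : (d m : ℕ) → (lam gram eps : ℝ) → IterMethod d),
      0 < C ∧
      ∀ (d m : ℕ) (lam eps : ℝ) (a : Fin m → EuclideanSpace ℝ (Fin d)) (b : Fin m → ℝ)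
        (x₀ : EuclideanSpace ℝ (Fin d)),
        0 < m → 0 < lam → 0 < eps →
        let f : EuclideanSpace ℝ (Fin d) → ℝ := svmObj lam a b
        let fmu : EuclideanSpace ℝ (Fin d) → ℝ := smoothObj (eps / 4) lam a b
        let G : ℝ := gramNorm a b
        let M : IterMethod d := A d m lam G eps
        let Z : ℝ := MvPolynomial.aeval ![(d : ℝ), (m : ℝ), lam, lam⁻¹, G, ‖x₀‖] P
        ∃ xs : EuclideanSpace ℝ (Fin d), (∀ x, f xs ≤ f x) ∧
          (∀ N : ℕ,
            C * ((d * (lam + G ^ 2) / lam) ^ (1 / 5 : ℝ) / eps ^ (3 / 5 : ℝ)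
              * logO ((f x₀ - f xs) / eps)) ≤ N →
            f (M.iter fmu x₀ N) - f xs ≤ eps) ∧
          (∀ n : ℕ, (M.iterCalls fmu x₀ n : ℝ) ≤ C * logO (Z / eps) ^ k) := by
  refine ⟨10, 1, sizePoly, svmMethod, by norm_num, ?_⟩
  intro d m lam eps a b x₀ hm hlam heps
  dsimp only
  obtain ⟨xs, hxs⟩ := exists_svmObj_min (a := a) (b := b) hlam
  refine ⟨xs, hxs, fun N hN => ?_, fun n => ?_⟩
  · change 10 * (budget d lam (gramNorm a b) eps * _) ≤ _ at hN
    have hmu : 0 < eps / 4 := by positivity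
    -- For `d = 0` the budget vanishes and `N = 0` is allowed, but the space is a single point. For
    -- `d > 0` the budget is positive, so `N ≠ 0` and the iterate is a machine output rather than
    -- `x₀`.
    rcases Nat.eq_zero_or_pos d with rfl | hd
    · rw [Subsingleton.elim (IterMethod.iter _ _ _ _) xs, sub_self]
      exact heps.le
    have hsm : ∀ x, smoothObj (eps / 4) lam a b x ≤ smoothObj (eps / 4) lam a b xs + eps / 2 →
        svmObj lam a b x - svmObj lam a b xs ≤ eps := by
      intro x hx
      linarith [svmObj_le_smoothObj (lam := lam) (a := a) (b := b) hmu x,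
        smoothObj_le_svmObj_add (lam := lam) (a := a) (b := b) hmu hm xs]
    have hB0 : 0 < budget d lam (gramNorm a b) eps := by
      unfold budget; positivity
    have hN' : 10 * budget d lam (gramNorm a b) eps ≤ N :=
      le_trans (by gcongr; exact le_mul_of_one_le_right hB0.le (one_le_logO _)) hN
    unfold svmMethod
    split_ifs with h1 h2
    · have hN0 : N ≠ 0 := by
        rintro rfl
        rw [Nat.cast_zero] at hN'
        linarith
      rw [GradMachine.toMethod_iter _ _ _ _ hN0]
      change svmObj lam a b 0 - _ ≤ _
      linarith [svmObj_zero_le (lam := lam) (a := a) (b := b) hm,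
        svmObj_nonneg (a := a) (b := b) hlam xs]
    · exact hsm _ (cutMachine_svm_gap hd hm hlam heps (not_le.1 h1).le hxs x₀ (by linarith))
    · exact hsm _ (accelMachine_svm_gap hd hm hlam heps (not_le.1 h1).le (not_le.1 h2) xs x₀ hN')
  · rw [pow_one, aeval_sizePoly]
    exact svmMethod_iterCalls_le _ _ _ _
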